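/- Theorem (A bottleneck matching for points on a circle can be found in $O(n)$ time). Let $v_0, v_1, \ldots, v_{2n-1}$ be $2n$ distinct points on a circle in the plane, listed in counterclockwise order around the circle, $n$ of them red and $n$ of them blue. A matching is a perfect matching of the red points with the blue points by $n$ straight line segments, no two of which cross; its value is the length of its longest segment, and a bottleneck matching is a matching of minimum value. There is an algorithm (a single real RAM program, working for all $n$, with unit cost for each elementary operation) which, given the coordinates and colors of the points in this order, outputs a bottleneck matching (for each point, the index of its partner) in $O(n)$ time, i.e. after at most $C(n+1)$ steps, where $C$ is an absolute constant. The machine uses only exact addition, subtraction, multiplication and comparison of real numbers, integer constants, successor, predecessor and comparison of natural numbers, and access to array cells by index. -/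

import Mathlib

/-! ### A real RAM with step count

Programs of a real random access machine, in structured form.  The memory consists of arrays of
natural numbers and arrays of real numbers; the name of an array is a constant of the program, so a
program uses finitely many arrays, and a cell is reached by an index computed at run time.  Every
elementary operation costs one step.  On real numbers there are exact `+`, `-`, `*`, comparison and
integer constants; there is no rounding, no conversion of reals to indices, and no root or
division.  On natural numbers there are only successor, predecessor and comparison, so that after
`t` steps no stored natural number exceeds the largest number initially in memory or in the program
by more than `t` (words of logarithmic length). -/

namespace RealRAM

structure State where
  /-- `nat a i` is cell `i` of the array `a` of natural numbers -/
  nat : ℕ → ℕ → ℕ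
  /-- `real a i` is cell `i` of the array `a` of real numbers -/
  real : ℕ → ℕ → ℝ

/-- Index expressions. -/
inductive NExp where
  | lit (k : ℕ)
  | get (a : ℕ) (i : NExp)
  | succ (e : NExp)
  | pred (e : NExp)

/-- Real expressions. -/
inductive RExp where
  | lit (k : ℤ)
  | get (a : ℕ) (i : NExp)
  | add (e f : RExp)
  | sub (e f : RExp)
  | mul (e f : RExp)

/-- Tests. -/
inductive Test where
  | natLt (e f : NExp)
  | natEq (e f : NExp)
  | realLt (e f : RExp)
  | realEq (e f : RExp)
  | not (b : Test)
  | and (b c : Test)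

/-- Programs. -/
inductive Program where
  | nop
  | setNat (a : ℕ) (i e : NExp)
  | setReal (a : ℕ) (i : NExp) (e : RExp)
  | seq (c d : Program)
  | ite (b : Test) (c d : Program)
  | loop (b : Test) (c : Program)

def NExp.eval (s : State) : NExp → ℕ
  | .lit k => k
  | .get a i => s.nat a (i.eval s)
  | .succ e => e.eval s + 1
  | .pred e => e.eval s - 1

def NExp.cost : NExp → ℕ
  | .lit _ => 1
  | .get _ i => i.cost + 1
  | .succ e => e.cost + 1
  | .pred e => e.cost + 1

noncomputable def RExp.eval (s : State) : RExp → ℝ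
  | .lit k => (k : ℝ)
  | .get a i => s.real a (i.eval s)
  | .add e f => e.eval s + f.eval s
  | .sub e f => e.eval s - f.eval s
  | .mul e f => e.eval s * f.eval s

def RExp.cost : RExp → ℕ
  | .lit _ => 1
  | .get _ i => i.cost + 1
  | .add e f => e.cost + f.cost + 1
  | .sub e f => e.cost + f.cost + 1
  | .mul e f => e.cost + f.cost + 1

def Test.eval (s : State) : Test → Prop
  | .natLt e f => e.eval s < f.eval s
  | .natEq e f => e.eval s = f.eval s
  | .realLt e f => e.eval s < f.eval s
  | .realEq e f => e.eval s = f.eval s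
  | .not b => ¬ b.eval s
  | .and b c => b.eval s ∧ c.eval s

def Test.cost : Test → ℕ
  | .natLt e f => e.cost + f.cost + 1
  | .natEq e f => e.cost + f.cost + 1
  | .realLt e f => e.cost + f.cost + 1
  | .realEq e f => e.cost + f.cost + 1
  | .not b => b.cost + 1
  | .and b c => b.cost + c.cost + 1

def State.setNat (s : State) (a i v : ℕ) : State :=
  { s with nat := Function.update s.nat a (Function.update (s.nat a) i v) }

def State.setReal (s : State) (a i : ℕ) (v : ℝ) : State :=
  { s with real := Function.update s.real a (Function.update (s.real a) i v) }

/-- `Exec c s s' t`: the program `c`, started in the state `s`, halts in the state `s'` after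
exactly `t` steps. -/
inductive Exec : Program → State → State → ℕ → Prop where
  | nop (s : State) : Exec .nop s s 1
  | setNat (s : State) (a : ℕ) (i e : NExp) :
      Exec (.setNat a i e) s (s.setNat a (i.eval s) (e.eval s)) (i.cost + e.cost + 1)
  | setReal (s : State) (a : ℕ) (i : NExp) (e : RExp) :
      Exec (.setReal a i e) s (s.setReal a (i.eval s) (e.eval s)) (i.cost + e.cost + 1)
  | seq {c d : Program} {s s' s'' : State} {t u : ℕ} :
      Exec c s s' t → Exec d s' s'' u → Exec (.seq c d) s s'' (t + u)
  | iteTrue {b : Test} {c d : Program} {s s' : State} {t : ℕ} :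
      b.eval s → Exec c s s' t → Exec (.ite b c d) s s' (b.cost + t + 1)
  | iteFalse {b : Test} {c d : Program} {s s' : State} {t : ℕ} :
      ¬ b.eval s → Exec d s s' t → Exec (.ite b c d) s s' (b.cost + t + 1)
  | loopStop {b : Test} {c : Program} {s : State} :
      ¬ b.eval s → Exec (.loop b c) s s (b.cost + 1)
  | loopStep {b : Test} {c : Program} {s s' s'' : State} {t u : ℕ} :
      b.eval s → Exec c s s' t → Exec (.loop b c) s' s'' u →
      Exec (.loop b c) s s'' (b.cost + t + u + 1)

end RealRAM

/-! ### Bichromatic non-crossing matchings -/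

namespace BottleneckMatching

/-- The points `p 0, …, p (2n - 1)` are distinct, lie on a circle, and are listed in
counterclockwise order around it. -/
def OnCircle {n : ℕ} (p : Fin (2 * n) → EuclideanSpace ℝ (Fin 2)) : Prop :=
  ∃ (c : EuclideanSpace ℝ (Fin 2)) (r : ℝ) (θ : Fin (2 * n) → ℝ),
    0 < r ∧ StrictMono θ ∧ (∀ i j, θ j < θ i + 2 * Real.pi) ∧
    ∀ i, p i = !₂[c 0 + r * Real.cos (θ i), c 1 + r * Real.sin (θ i)]

/-- There are `n` red points among the `2n` points (the other `n` points are blue). -/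
def Balanced {n : ℕ} (red : Fin (2 * n) → Bool) : Prop :=
  (Finset.univ.filter fun i => red i = true).card = n

/-- `m` maps each point to its partner in a perfect matching of red points with blue points by
straight line segments, and no two of the segments meet. -/
structure IsMatching {n : ℕ} (p : Fin (2 * n) → EuclideanSpace ℝ (Fin 2))
    (red : Fin (2 * n) → Bool) (m : Fin (2 * n) → Fin (2 * n)) : Prop where
  involutive : ∀ i, m (m i) = i
  bichromatic : ∀ i, red (m i) ≠ red i
  noncrossing : ∀ i j, j ≠ i → j ≠ m i →
    Disjoint (segment ℝ (p i) (p (m i))) (segment ℝ (p j) (p (m j)))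

/-- The length of a longest segment of the matching `m`. -/
noncomputable def bn {n : ℕ} (p : Fin (2 * n) → EuclideanSpace ℝ (Fin 2))
    (m : Fin (2 * n) → Fin (2 * n)) : ℝ :=
  ⨆ i, dist (p i) (p (m i))

/-- A matching of minimum value. -/
def IsBottleneck {n : ℕ} (p : Fin (2 * n) → EuclideanSpace ℝ (Fin 2))
    (red : Fin (2 * n) → Bool) (m : Fin (2 * n) → Fin (2 * n)) : Prop :=
  IsMatching p red m ∧ ∀ m', IsMatching p red m' → bn p m ≤ bn p m'

/-- The input: the number `2n` of points in cell `0` of the natural-number array `0`, the colors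
(`1` for red, `0` for blue) in the natural-number array `1`, the coordinates of the points in the
real arrays `0` and `1`; all other cells contain `0`. -/
noncomputable def input {n : ℕ} (p : Fin (2 * n) → EuclideanSpace ℝ (Fin 2))
    (red : Fin (2 * n) → Bool) : RealRAM.State where
  nat a i :=
    if a = 0 then (if i = 0 then 2 * n else 0)
    else if a = 1 then (if h : i < 2 * n then (if red ⟨i, h⟩ = true then 1 else 0) else 0)
    else 0
  real a i :=
    if h : i < 2 * n then
      (if a = 0 then p ⟨i, h⟩ 0 else if a = 1 then p ⟨i, h⟩ 1 else 0)
    else 0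

/-- The output: cell `i` of the natural-number array `2` contains the partner of the point `i`. -/
def Outputs {n : ℕ} (s : RealRAM.State) (m : Fin (2 * n) → Fin (2 * n)) : Prop :=
  ∀ i : Fin (2 * n), s.nat 2 (i : ℕ) = (m i : ℕ)

end BottleneckMatching

/-! Read the colors as a periodic walk: red steps go up, blue steps go down. Here `N` denotes the
number of all points. The level of a point is the lower end of its step. Around the circle, points
of one level alternate in color, so each point forms a bichromatic pair with the preceding and with
the following point of its level. Of the two ways to pair up a level, a threshold `t` takes the
red-to-blue arcs (excursions upward) on levels at least `t` and the blue-to-red arcs (excursions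
downward) on levels below `t`. The selected arcs are excursions of the walk away from height `t`;
such excursions are nested or separated, so every threshold gives a non-crossing perfect matching
(`sel_prv`, `Excursion.nested`, `Sel.disjoint`).

Some threshold is optimal. Given any non-crossing matching, cut the circle where none of the short
arcs of its segments passes (`exists_cut`), and let `t` be the height at the cut. An excursion away
from `t` cannot contain the cut. While the height differs from `t`, the points since the cut are
unbalanced, so an arc of the given matching must reach further; since arcs do not cross, one arc
covers the whole excursion (`exists_covering`). That arc is at most a half circle, hence its chord
is at least as long as the chord of the excursion (`exists_threshold`).

It remains to minimize over `t` the larger of the longest downward arc on levels below `t` and the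
longest upward arc on levels from `t` on. Two pointers closing in on `t` find the minimum in linear
time without prefix maxima (`ThresholdInv.step`). Squared lengths suffice for all comparisons, so no
roots are needed. -/

namespace BottleneckMatching

/-! ### Levels of a cyclic sequence of colors -/

section Levels

variable (N : ℕ) (col : ℕ → Bool)

/-- The excess of red over blue points among the first `r` points, shifted by `N`. -/
def height : ℕ → ℕ
  | 0 => N
  | r + 1 => if col r then height r + 1 else height r - 1

/-- The smaller one of the heights before and after the point `r`. -/
def level (r : ℕ) : ℕ := if col r then height N col r else height N col r - 1

/-- `lastAt r k` is the residue modulo `N` of the last point of level `k` before `r`. -/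
def lastAt : ℕ → ℕ → ℕ
  | 0 => fun _ => 0
  | r + 1 => Function.update (lastAt r) (level N col r) (r % N)

/-- The cyclically preceding point of the same level. -/
def prv (i : ℕ) : ℕ := lastAt N col (N + i) (level N col (N + i))

/-- `1` for red points and `-1` for blue points. -/
def sgn (r : ℕ) : ℤ := if col r then 1 else -1

/-- The points `y < x` have the same level, and no point in between has that level. -/
def Consec (y x : ℕ) : Prop :=
  y < x ∧ level N col y = level N col x ∧ ∀ z, y < z → z < x → level N col z ≠ level N col x

/-- The matching with threshold `t` contains the pair formed by `i` and its predecessor. -/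
def Sel (t i : ℕ) : Prop := level N col (N + i) < t ↔ col (prv N col i) = false

end Levels

variable {N : ℕ} {col : ℕ → Bool}

/-! ### Heights and levels of the periodic walk -/

theorem sub_le_height (r : ℕ) : N - r ≤ height N col r := by
  induction r with
  | zero => simp [height]
  | succ r ih => rw [height]; split <;> omega

theorem height_le (r : ℕ) : height N col r ≤ N + r := by
  induction r with
  | zero => simp [height]
  | succ r ih => rw [height]; split <;> omega

theorem height_eq_sum {r : ℕ} (hr : r ≤ N) :
    (height N col r : ℤ) = N + ∑ i ∈ Finset.range r, sgn col i := by
  induction r with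
  | zero => simp [height]
  | succ r ih =>
    have h1 := ih (by omega)
    have h2 := sub_le_height (N := N) (col := col) r
    rw [Finset.sum_range_succ, height, sgn]
    split
    · push_cast; linarith
    · have : ((height N col r - 1 : ℕ) : ℤ) = height N col r - 1 := by omega
      rw [this]; linarith

/-- The colors are periodic and balanced. -/
structure Cyclic (N : ℕ) (col : ℕ → Bool) : Prop where
  pos : 0 < N
  periodic : ∀ r, col (r + N) = col r
  balanced : ∑ i ∈ Finset.range N, sgn col i = 0

namespace Cyclic

theorem height_self (h : Cyclic N col) : height N col N = N := by
  have := height_eq_sum (N := N) (col := col) le_rfl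
  rw [h.balanced] at this; omega

theorem height_add (h : Cyclic N col) (r : ℕ) : height N col (r + N) = height N col r := by
  induction r with
  | zero => simpa [height] using h.height_self
  | succ r ih => rw [show r + 1 + N = (r + N) + 1 by ring, height, height, ih, h.periodic]

theorem col_add_mul (h : Cyclic N col) (r a : ℕ) : col (r + N * a) = col r := by
  induction a with
  | zero => simp
  | succ a ih => rw [Nat.mul_succ, ← add_assoc, h.periodic, ih]

theorem height_add_mul (h : Cyclic N col) (r a : ℕ) :
    height N col (r + N * a) = height N col r := by
  induction a with
  | zero => simp
  | succ a ih => rw [Nat.mul_succ, ← add_assoc, h.height_add, ih]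

theorem level_add_mul (h : Cyclic N col) (r a : ℕ) :
    level N col (r + N * a) = level N col r := by
  rw [level, level, h.col_add_mul, h.height_add_mul]

theorem col_mod (h : Cyclic N col) (r : ℕ) : col (r % N) = col r := by
  conv_rhs => rw [← Nat.mod_add_div r N, h.col_add_mul]

theorem height_mod (h : Cyclic N col) (r : ℕ) : height N col (r % N) = height N col r := by
  conv_rhs => rw [← Nat.mod_add_div r N, h.height_add_mul]

theorem level_mod (h : Cyclic N col) (r : ℕ) : level N col (r % N) = level N col r := by
  conv_rhs => rw [← Nat.mod_add_div r N, h.level_add_mul]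

theorem level_add (h : Cyclic N col) (r : ℕ) : level N col (N + r) = level N col r := by
  simpa [add_comm] using h.level_add_mul r 1

/-- The starting height `N` cannot be used up within one period, and the walk is periodic. Hence the
natural subtraction in `height` and `level` never truncates. -/
theorem height_pos (h : Cyclic N col) (r : ℕ) : 0 < height N col r := by
  rw [← h.height_mod]
  have := sub_le_height (N := N) (col := col) (r % N)
  have := Nat.mod_lt r h.pos
  omega

theorem red_step (_h : Cyclic N col) {r : ℕ} (hr : col r = true) :
    height N col (r + 1) = height N col r + 1 ∧ level N col r = height N col r := by
  simp [height, level, hr]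

theorem blue_step (h : Cyclic N col) {r : ℕ} (hr : col r = false) :
    height N col r = height N col (r + 1) + 1 ∧ level N col r = height N col (r + 1) := by
  have := h.height_pos r
  simp [height, level, hr]; omega

theorem level_lt (h : Cyclic N col) (r : ℕ) : level N col r < 2 * N := by
  rw [← h.level_mod]
  have h1 := height_le (N := N) (col := col) (r % N)
  have := Nat.mod_lt r h.pos
  unfold level; split <;> omega

theorem height_lt (h : Cyclic N col) (r : ℕ) : height N col r < 2 * N := by
  rw [← h.height_mod]
  have h1 := height_le (N := N) (col := col) (r % N)
  have := Nat.mod_lt r h.pos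
  omega

theorem height_sub (h : Cyclic N col) {a b : ℕ} (hab : a ≤ b) :
    (height N col b : ℤ) - height N col a = ∑ i ∈ Finset.Ico a b, sgn col i := by
  induction b, hab using Nat.le_induction with
  | base => simp
  | succ b hab ih =>
    rw [Finset.sum_Ico_succ_top hab, ← ih, sgn]
    rcases hb : col b
    · have := (h.blue_step hb).1; simp; omega
    · have := (h.red_step hb).1; simp; omega

end Cyclic

/-! ### Consecutive points of one level -/

theorem lastAt_spec {r k : ℕ} (hk : ∃ j < r, level N col j = k) :
    ∃ j < r, level N col j = k ∧ (∀ z, j < z → z < r → level N col z ≠ k) ∧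
      lastAt N col r k = j % N := by
  induction r with
  | zero => simp at hk
  | succ r ih =>
    by_cases hr : level N col r = k
    · exact ⟨r, by omega, hr, fun z _ _ => by omega, by simp [lastAt, hr]⟩
    · obtain ⟨j, hj, hjk⟩ := hk
      have hjr : j ≠ r := by rintro rfl; exact hr hjk
      obtain ⟨i, hi, hik, hbet, hl⟩ := ih ⟨j, by omega, hjk⟩
      refine ⟨i, by omega, hik, fun z hz1 hz2 => ?_, ?_⟩
      · rcases Nat.lt_succ_iff_lt_or_eq.1 hz2 with h | rfl
        · exact hbet z hz1 h
        · exact hr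
      · rw [lastAt, Function.update_of_ne (Ne.symm hr), hl]

/-- A discrete intermediate value argument: to come back down, the walk would have to make a step on
the level of `y`. -/
theorem Consec.above (h : Cyclic N col) {y x : ℕ} (hc : Consec N col y x) (hy : col y = true) :
    ∀ g, y < g → g ≤ x → level N col y < height N col g := by
  intro g hg
  induction g, hg using Nat.le_induction with
  | base => intro _; have := h.red_step hy; simp only [Nat.succ_eq_add_one]; omega
  | succ g hg ih =>
    intro hx
    have h1 := ih (by omega)
    have h2 := hc.2.2 g (by omega) (by omega)
    rw [← hc.2.1] at h2
    rcases hcg : col g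
    · have := h.blue_step hcg; omega
    · have := h.red_step hcg; omega

theorem Consec.below (h : Cyclic N col) {y x : ℕ} (hc : Consec N col y x) (hy : col y = false) :
    ∀ g, y < g → g ≤ x → height N col g ≤ level N col y := by
  intro g hg
  induction g, hg using Nat.le_induction with
  | base => intro _; have := h.blue_step hy; simp only [Nat.succ_eq_add_one]; omega
  | succ g hg ih =>
    intro hx
    have h1 := ih (by omega)
    have h2 := hc.2.2 g (by omega) (by omega)
    rw [← hc.2.1] at h2
    rcases hcg : col g
    · have := h.blue_step hcg; omega
    · have := h.red_step hcg; omega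

/-- After an upward step the walk stays above the level until it next uses that level, which it can
then only do downward; symmetrically for a downward step. -/
theorem Consec.col_ne (h : Cyclic N col) {y x : ℕ} (hc : Consec N col y x) : col y ≠ col x := by
  intro he
  have h3 := hc.2.1
  rcases hy : col y
  · have h1 := hc.below h hy x hc.1 le_rfl
    have h2 := h.blue_step (r := x) (by rw [← he, hy]); omega
  · have h1 := hc.above h hy x hc.1 le_rfl
    have h2 := h.red_step (r := x) (by rw [← he, hy]); omega

theorem Consec.add_mul (h : Cyclic N col) {y x : ℕ} (hc : Consec N col y x) (a : ℕ) :
    Consec N col (y + N * a) (x + N * a) := by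
  refine ⟨by have := hc.1; omega, by rw [h.level_add_mul, h.level_add_mul, hc.2.1], fun z h1 h2 => ?_⟩
  have := hc.2.2 (z - N * a) (by omega) (by omega)
  rw [← h.level_add_mul _ a, Nat.sub_add_cancel (by omega)] at this
  rwa [h.level_add_mul]

/-- The point `y + N` already has the level of `y`, so `x` comes no later; it is not `x` itself,
because it has the color of `y`. -/
theorem Consec.lt_add (h : Cyclic N col) {y x : ℕ} (hc : Consec N col y x) : x < y + N := by
  have h1 := h.level_add_mul y 1
  have h2 := h.col_add_mul y 1
  rw [mul_one] at h1 h2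
  by_contra! hx
  rcases hx.eq_or_lt with he | hlt
  · exact hc.col_ne h (by rw [← he, h2])
  · exact hc.2.2 (y + N) (by have := h.pos; omega) hlt (h1.trans hc.2.1)

theorem Consec.right_unique {y x x' : ℕ} (hc : Consec N col y x) (hc' : Consec N col y x') :
    x = x' := by
  rcases lt_trichotomy x x' with hl | he | hl
  · exact absurd (hc.2.1.symm.trans hc'.2.1) (hc'.2.2 x hc.1 hl)
  · exact he
  · exact absurd (hc'.2.1.symm.trans hc.2.1) (hc.2.2 x' hc'.1 hl)

theorem Consec.mod_unique (h : Cyclic N col) {y x y' x' : ℕ} (hc : Consec N col y x)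
    (hc' : Consec N col y' x') (hy : y % N = y' % N) : x % N = x' % N := by
  have h1 := hc.add_mul h (y' / N)
  have h2 := hc'.add_mul h (y / N)
  have h3 : y + N * (y' / N) = y' + N * (y / N) := by
    have := Nat.mod_add_div y N; have := Nat.mod_add_div y' N; omega
  rw [h3] at h1
  have := congrArg (· % N) (h1.right_unique h2)
  simpa using this

theorem prv_spec (h : Cyclic N col) (i : ℕ) :
    ∃ y, Consec N col y (N + i) ∧ prv N col i = y % N := by
  obtain ⟨j, hj, h1, h2, h3⟩ := lastAt_spec (N := N) (col := col) (r := N + i)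
    (k := level N col (N + i)) ⟨i, by have := h.pos; omega, (h.level_add i).symm⟩
  exact ⟨j, ⟨hj, h1, h2⟩, h3⟩

theorem prv_lt (h : Cyclic N col) (i : ℕ) : prv N col i < N := by
  obtain ⟨y, -, hy⟩ := prv_spec h i
  rw [hy]; exact Nat.mod_lt _ h.pos

theorem prv_injOn (h : Cyclic N col) {i j : ℕ} (hi : i < N) (hj : j < N)
    (hij : prv N col i = prv N col j) : i = j := by
  obtain ⟨y, hy, hy'⟩ := prv_spec h i
  obtain ⟨z, hz, hz'⟩ := prv_spec h j
  have := hy.mod_unique h hz (by omega)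
  simpa [Nat.mod_eq_of_lt hi, Nat.mod_eq_of_lt hj] using this

theorem level_prv (h : Cyclic N col) (i : ℕ) : level N col (prv N col i) = level N col i := by
  obtain ⟨y, hy, hy'⟩ := prv_spec h i
  rw [hy', h.level_mod, hy.2.1, h.level_add]

theorem col_prv (h : Cyclic N col) (i : ℕ) : col (prv N col i) = !col i := by
  obtain ⟨y, hy, hy'⟩ := prv_spec h i
  have h1 := hy.col_ne h
  have h2 := h.periodic i
  rw [add_comm] at h2
  rw [h2] at h1
  rw [hy', h.col_mod]
  rcases h3 : col y <;> rcases h4 : col i <;> simp_all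

/-- Level is preserved and color flipped by `prv`, so exactly one of the two arcs at each point is
selected. This makes the selected pairs a perfect matching. -/
theorem sel_prv (h : Cyclic N col) {t i : ℕ} : Sel N col t (prv N col i) ↔ ¬ Sel N col t i := by
  simp only [Sel, h.level_add, level_prv h, col_prv h]
  rcases col i <;> simp

theorem exists_prv_eq (h : Cyclic N col) {j : ℕ} (hj : j < N) : ∃ i < N, prv N col i = j := by
  let f : Fin N → Fin N := fun i => ⟨prv N col i, prv_lt h i⟩
  have hf : Function.Injective f := fun a b hab =>
    Fin.ext (prv_injOn h a.2 b.2 (congrArg Fin.val hab))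
  obtain ⟨i, hi⟩ := Finite.surjective_of_injective hf ⟨j, hj⟩
  exact ⟨i, i.2, congrArg Fin.val hi⟩

/-- `y` and `x` enclose an excursion of `|height - t|`. -/
def Excursion (N : ℕ) (col : ℕ → Bool) (t y x : ℕ) : Prop :=
  Consec N col y x ∧ (level N col y < t ↔ col y = false)

theorem Sel.excursion (h : Cyclic N col) {t i : ℕ} (hs : Sel N col t i) :
    ∃ y, Excursion N col t y (N + i) ∧ prv N col i = y % N := by
  obtain ⟨y, hy, hy'⟩ := prv_spec h i
  refine ⟨y, ⟨hy, ?_⟩, hy'⟩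
  rwa [Sel, hy', h.col_mod, ← hy.2.1] at hs

theorem Excursion.add_mul (h : Cyclic N col) {t y x : ℕ} (hc : Excursion N col t y x) (a : ℕ) :
    Excursion N col t (y + N * a) (x + N * a) :=
  ⟨hc.1.add_mul h a, by rw [h.level_add_mul, h.col_add_mul]; exact hc.2⟩

theorem Excursion.of_add_mul (h : Cyclic N col) {t y x a : ℕ}
    (hc : Excursion N col t (y + N * a) (x + N * a)) : Excursion N col t y x := by
  obtain ⟨⟨h1, h2, h3⟩, h4⟩ := hc
  rw [h.level_add_mul] at h2 h4
  rw [h.level_add_mul] at h2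
  rw [h.col_add_mul] at h4
  refine ⟨⟨by omega, h2, fun z hz1 hz2 => ?_⟩, h4⟩
  have := h3 (z + N * a) (by omega) (by omega)
  rwa [h.level_add_mul, h.level_add_mul] at this

/-- An excursion can be shifted so that it begins in the first period. -/
theorem Excursion.exists_lt (h : Cyclic N col) {t y x : ℕ} (hc : Excursion N col t y x) :
    ∃ y' x', Excursion N col t y' x' ∧ y' < N ∧ y' % N = y % N ∧ x' % N = x % N := by
  have e := Nat.mod_add_div y N
  have hx : x = x - N * (y / N) + N * (y / N) := by have := hc.1.1; omega
  refine ⟨y % N, x - N * (y / N), Excursion.of_add_mul h (a := y / N) (by rwa [← hx, e]),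
    Nat.mod_lt _ h.pos, by simp, ?_⟩
  conv_rhs => rw [hx, Nat.add_mul_mod_self_left]

/-- An upward excursion stays strictly above a level that is at least `t`; a downward one stays at
or below a level that is less than `t`. -/
theorem Excursion.height_ne (h : Cyclic N col) {t y x g : ℕ} (hc : Excursion N col t y x)
    (h1 : y < g) (h2 : g ≤ x) : height N col g ≠ t := by
  have h3 := hc.2
  rcases hy : col y
  · have := hc.1.below h hy g h1 h2
    simp only [hy] at h3; simp at h3; omega
  · have := hc.1.above h hy g h1 h2
    simp only [hy] at h3; simp at h3; omega

/-- Two excursions are nested if one begins inside the other one. -/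
theorem Excursion.nested (h : Cyclic N col) {t y x b a : ℕ} (hc : Excursion N col t y x)
    (hd : Excursion N col t b a) (h1 : y < b) (h2 : b < x) : a < x := by
  have h3 := hc.2
  have h4 := hd.2
  have h5 := hc.1.2.1
  have h6 := hd.1.2.1
  have h7 := hc.1.2.2 b h1 h2
  have h8 := hc.1.col_ne h
  rcases hy : col y
  · have hx : col x = true := by rcases hx : col x <;> simp_all
    have hcb := hc.1.below h hy b h1 h2.le
    have hcb' := hc.1.below h hy (b + 1) (by omega) h2
    have hs := h.red_step hx
    rw [hy] at h3; simp at h3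
    -- A red `b` would have its level equal to its height, which is below `t` here; selection allows
    -- only blue beginnings below `t`.
    have hb : col b = false := by
      rcases hb : col b
      · rfl
      · have := h.red_step hb
        rw [hb] at h4; simp at h4; omega
    have hbs := h.blue_step hb
    have hbl : level N col b < level N col y := by omega
    -- An excursion from `b` lasting beyond `x` would keep the height at most the level of `b`
    -- through `x + 1`, but the step at `x` raises it above the level of `y`.
    by_contra! hax
    have hx2 := hd.1.below h hb
    rcases hax.eq_or_lt with he | hlt
    · subst he; omega
    · have := hx2 (x + 1) (by omega) hlt; omega
  · have hx : col x = false := by rcases hx : col x <;> simp_all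
    have hcb := hc.1.above h hy b h1 h2.le
    have hcb' := hc.1.above h hy (b + 1) (by omega) h2
    have hs := h.blue_step hx
    rw [hy] at h3; simp at h3
    have hb : col b = true := by
      rcases hb : col b
      · have := h.blue_step hb
        rw [hb] at h4; simp at h4; omega
      · rfl
    have hbs := h.red_step hb
    have hbl : level N col y < level N col b := by omega
    by_contra! hax
    have hx2 := hd.1.above h hb
    rcases hax.eq_or_lt with he | hlt
    · subst he; omega
    · have := hx2 (x + 1) (by omega) hlt; omega

/-- Both ends of an arc share a level but differ in color, while the selection rule fixes the color
of a beginning from its level. -/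
theorem Excursion.right_ne_left (h : Cyclic N col) {t y x a : ℕ} (hc : Excursion N col t y x) :
    ¬ Excursion N col t x a := by
  intro hd
  have h1 := hc.2; have h2 := hd.2; have h3 := hc.1.col_ne h
  rw [hc.1.2.1] at h1
  rcases hy : col y <;> rcases hx : col x <;> simp_all

/-- A stretch on which the height avoids its value at the beginning `g` of the window is covered
by an arc of every non-crossing bichromatic matching of the window. -/
theorem exists_covering (h : Cyclic N col) {g : ℕ} {M : ℕ → ℕ}
    (hM : ∀ i, g ≤ i → i < g + N → g ≤ M i ∧ M i < g + N ∧ M (M i) = i ∧ col (M i) ≠ col i)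
    (hcross : ∀ p q, g ≤ p → p < q → q < M p → M p < M q → M q < g + N → False)
    {y x : ℕ} (hgy : g ≤ y) (hyx : y < x) (hx : x < g + N)
    (hne : ∀ z, y < z → z ≤ x → height N col z ≠ height N col g) :
    ∃ p, g ≤ p ∧ p ≤ y ∧ x ≤ M p ∧ M p < g + N := by
  -- If no arc leaves the points from `g` to `z`, then `M` pairs them among themselves with opposite
  -- colors, their signs cancel, and the height returns to its value at `g`.
  have key : ∀ z, g ≤ z → z < g + N → height N col (z + 1) ≠ height N col g →
      ∃ p, g ≤ p ∧ p ≤ z ∧ z < M p := by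
    intro z hz1 hz2 hz
    by_contra! hno
    apply hz
    have h1 := h.height_sub (a := g) (b := z + 1) (by omega)
    have h2 : ∑ i ∈ Finset.Ico g (z + 1), sgn col i = 0 := by
      refine Finset.sum_involution (fun i _ => M i) ?_ ?_ ?_ ?_
      · intro i hi
        rw [Finset.mem_Ico] at hi
        have := (hM i hi.1 (by omega)).2.2.2
        simp only [sgn]
        rcases h3 : col i <;> rcases h4 : col (M i) <;> simp_all
      · intro i hi _ he
        rw [Finset.mem_Ico] at hi
        exact (hM i hi.1 (by omega)).2.2.2 (by rw [he])
      · intro i hi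
        rw [Finset.mem_Ico] at hi
        exact Finset.mem_Ico.2 ⟨(hM i hi.1 (by omega)).1,
          Nat.lt_succ_of_le (hno i hi.1 (by omega))⟩
      · intro i hi
        rw [Finset.mem_Ico] at hi
        exact (hM i hi.1 (by omega)).2.2.1
    omega
  let S := (Finset.Icc g y).filter fun p => y < M p
  have hS : S.Nonempty := by
    obtain ⟨p, h1, h2, h3⟩ := key y hgy (by omega) (hne (y + 1) (by omega) (by omega))
    exact ⟨p, Finset.mem_filter.2 ⟨Finset.mem_Icc.2 ⟨h1, h2⟩, h3⟩⟩
  obtain ⟨p, hp, hmax⟩ := Finset.exists_max_image S M hS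
  obtain ⟨hp1, hp2⟩ := Finset.mem_filter.1 hp
  rw [Finset.mem_Icc] at hp1
  have hMp := hM p hp1.1 (by omega)
  refine ⟨p, hp1.1, hp1.2, ?_, hMp.2.1⟩
  by_contra! hlt
  -- If the farthest arc from `p` ended before `x`, another arc would pass over `M p`: beginning
  -- before `p` it contradicts maximality, beginning after `p` it crosses.
  obtain ⟨q, hq1, hq2, hq3⟩ := key (M p) (by omega) (by omega) (hne _ (by omega) (by omega))
  have hMq := hM q hq1 (by omega)
  have hqne : q ≠ M p := by
    intro he; rw [he, hMp.2.2.1] at hq3; omega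
  rcases lt_trichotomy q p with hl | he | hl
  · have := hmax q (Finset.mem_filter.2 ⟨Finset.mem_Icc.2 ⟨hq1, by omega⟩, by omega⟩)
    omega
  · subst he; omega
  · exact hcross p q hp1.1 hl (by omega) hq3 hMq.2.1

end BottleneckMatching

namespace BottleneckMatching

/-! ### Chords of a circle -/

/-- The point at angle `θ` of a circle. -/
noncomputable def circlePoint (c : EuclideanSpace ℝ (Fin 2)) (r θ : ℝ) :
    EuclideanSpace ℝ (Fin 2) :=
  !₂[c 0 + r * Real.cos θ, c 1 + r * Real.sin θ]

/-- Twice the signed area of a triangle. -/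
def cross (u v w : EuclideanSpace ℝ (Fin 2)) : ℝ :=
  (v 0 - u 0) * (w 1 - u 1) - (v 1 - u 1) * (w 0 - u 0)

theorem cross_rotate (u v w : EuclideanSpace ℝ (Fin 2)) : cross v w u = cross u v w := by
  simp only [cross]; ring

theorem cross_swap (u v w : EuclideanSpace ℝ (Fin 2)) : cross u w v = -cross u v w := by
  simp only [cross]; ring

variable {c : EuclideanSpace ℝ (Fin 2)} {r : ℝ}

theorem cross_pos (hr : 0 < r) {α β γ : ℝ} (h1 : α < β) (h2 : β < γ)
    (h3 : γ < α + 2 * Real.pi) :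
    0 < cross (circlePoint c r α) (circlePoint c r β) (circlePoint c r γ) := by
  obtain ⟨A, hA⟩ : ∃ A, β = α + 2 * A := ⟨(β - α) / 2, by ring⟩
  obtain ⟨B, hB⟩ : ∃ B, γ = α + 2 * A + 2 * B := ⟨(γ - β) / 2, by rw [hA]; ring⟩
  -- In terms of the half-angles `A` and `B` the area becomes a product of sines of angles in `(0,
  -- π)`.
  have e : cross (circlePoint c r α) (circlePoint c r β) (circlePoint c r γ) =
      4 * r ^ 2 * (Real.sin A * Real.sin B * Real.sin (A + B)) := by
    have e1 : cross (circlePoint c r α) (circlePoint c r β) (circlePoint c r γ) =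
        r ^ 2 * (Real.sin (β - α) + Real.sin (γ - β) - Real.sin (γ - α)) := by
      simp only [cross, circlePoint, Real.sin_sub]
      simp
      ring
    rw [e1, show β - α = 2 * A by rw [hA]; ring, show γ - β = 2 * B by rw [hB, hA]; ring,
      show γ - α = 2 * A + 2 * B by rw [hB]; ring, Real.sin_add (2 * A), Real.sin_two_mul,
      Real.sin_two_mul, Real.cos_two_mul, Real.cos_two_mul, Real.sin_add]
    have s1 := Real.sin_sq_add_cos_sq A
    have s2 := Real.sin_sq_add_cos_sq B
    have s1' : Real.cos A ^ 2 = 1 - Real.sin A ^ 2 := by linarith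
    have s2' : Real.cos B ^ 2 = 1 - Real.sin B ^ 2 := by linarith
    rw [s1', s2']
    ring
  rw [e]
  have hA' : 0 < Real.sin A := Real.sin_pos_of_pos_of_lt_pi (by linarith) (by linarith)
  have hB' : 0 < Real.sin B := Real.sin_pos_of_pos_of_lt_pi (by linarith) (by linarith)
  have hAB : 0 < Real.sin (A + B) := Real.sin_pos_of_pos_of_lt_pi (by linarith) (by linarith)
  positivity

theorem dist_circlePoint_sq (α β : ℝ) :
    dist (circlePoint c r α) (circlePoint c r β) ^ 2 = r ^ 2 * (2 - 2 * Real.cos (β - α)) := by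
  rw [EuclideanSpace.dist_sq_eq, Fin.sum_univ_two, Real.dist_eq, Real.dist_eq, sq_abs, sq_abs,
    Real.cos_sub]
  simp [circlePoint]
  linear_combination r ^ 2 * Real.sin_sq_add_cos_sq α + r ^ 2 * Real.sin_sq_add_cos_sq β

/-- Chord length increases with the arc only up to a half circle, which is why the cut must avoid
short arcs. -/
theorem dist_circlePoint_le {α β γ δ : ℝ} (h1 : α ≤ β) (h2 : β ≤ γ) (h3 : γ ≤ δ)
    (h4 : δ - α ≤ Real.pi) :
    dist (circlePoint c r β) (circlePoint c r γ) ^ 2 ≤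
      dist (circlePoint c r α) (circlePoint c r δ) ^ 2 := by
  rw [dist_circlePoint_sq, dist_circlePoint_sq]
  have := Real.cos_le_cos_of_nonneg_of_le_pi (x := γ - β) (y := δ - α) (by linarith) h4
    (by linarith)
  have := sq_nonneg r
  gcongr

theorem cross_combo (u v a b : EuclideanSpace ℝ (Fin 2)) (s : ℝ) :
    cross u v ((1 - s) • a + s • b) = (1 - s) * cross u v a + s * cross u v b := by
  simp [cross]; ring

theorem mem_segment_iff_combo {a b x : EuclideanSpace ℝ (Fin 2)} :
    x ∈ segment ℝ a b ↔ ∃ s : ℝ, 0 ≤ s ∧ s ≤ 1 ∧ (1 - s) • a + s • b = x := by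
  rw [segment_eq_image]
  simp [and_assoc]

/-- The points `a` and `b` lie strictly on one side of the line through `u` and `v`. -/
theorem disjoint_segment_of_cross {u v a b : EuclideanSpace ℝ (Fin 2)}
    (h : 0 < cross u v a * cross u v b) : Disjoint (segment ℝ u v) (segment ℝ a b) := by
  rw [Set.disjoint_left]
  intro x hx hx'
  obtain ⟨s, hs0, hs1, rfl⟩ := mem_segment_iff_combo.1 hx
  obtain ⟨t, ht0, ht1, he⟩ := mem_segment_iff_combo.1 hx'
  have h1 : cross u v ((1 - s) • u + s • v) = 0 := by
    rw [cross_combo]; simp only [cross]; ring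
  rw [← he, cross_combo] at h1
  have h2 : cross u v a * ((1 - t) * cross u v a + t * cross u v b) = 0 := by rw [h1, mul_zero]
  have h3 : 0 < cross u v a ^ 2 := by
    have : cross u v a ≠ 0 := by rintro h0; simp [h0] at h
    positivity
  rcases ht0.eq_or_lt with h0 | h0
  · subst h0; nlinarith
  · have := mul_pos h0 h
    have := mul_nonneg (sub_nonneg.2 ht1) h3.le
    nlinarith

theorem not_disjoint_segment_of_cross {a b u v : EuclideanSpace ℝ (Fin 2)}
    (h1 : 0 < cross a b v) (h2 : cross a b u < 0) (h3 : 0 < cross u v a) (h4 : cross u v b < 0) :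
    ¬ Disjoint (segment ℝ a b) (segment ℝ u v) := by
  have hD : 0 < cross u v a - cross u v b := by linarith
  have hE : cross a b v - cross a b u = cross u v a - cross u v b := by
    simp only [cross]; ring
  rw [Set.not_disjoint_iff]
  refine ⟨_, mem_segment_iff_combo.2 ⟨cross u v a / (cross u v a - cross u v b), by positivity,
    by rw [div_le_one hD]; linarith, rfl⟩, mem_segment_iff_combo.2
    ⟨-cross a b u / (cross u v a - cross u v b), div_nonneg (by linarith) hD.le,
    by rw [div_le_one hD]; linarith, ?_⟩⟩
  have hne := hD.ne'
  ext i
  fin_cases i <;>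
  · simp
    field_simp
    simp only [cross]
    ring

/-- Chords with interleaved endpoints meet. -/
theorem not_disjoint_of_interleaved (hr : 0 < r) {α β γ δ : ℝ} (h1 : α < γ) (h2 : γ < β)
    (h3 : β < δ) (h4 : δ < α + 2 * Real.pi) :
    ¬ Disjoint (segment ℝ (circlePoint c r α) (circlePoint c r β))
      (segment ℝ (circlePoint c r γ) (circlePoint c r δ)) := by
  apply not_disjoint_segment_of_cross
  · exact cross_pos hr (by linarith) h3 h4
  · rw [cross_swap]; linarith [cross_pos (c := c) hr h1 h2 (by linarith)]
  · rw [cross_rotate]; exact cross_pos hr h1 (by linarith) h4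
  · rw [cross_swap]; linarith [cross_pos (c := c) hr h2 h3 (by linarith)]

theorem disjoint_of_nested (hr : 0 < r) {α β γ δ : ℝ} (h1 : α < γ) (h2 : γ < δ)
    (h3 : δ < β) (h4 : β < α + 2 * Real.pi) :
    Disjoint (segment ℝ (circlePoint c r α) (circlePoint c r β))
      (segment ℝ (circlePoint c r γ) (circlePoint c r δ)) := by
  apply disjoint_segment_of_cross
  rw [cross_swap, cross_swap _ (circlePoint c r δ), neg_mul_neg]
  exact mul_pos (cross_pos hr h1 (by linarith) h4) (cross_pos hr (by linarith) h3 h4)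

theorem disjoint_of_separated (hr : 0 < r) {α β γ δ : ℝ} (h1 : α < β) (h2 : β < γ)
    (h3 : γ < δ) (h4 : δ < α + 2 * Real.pi) :
    Disjoint (segment ℝ (circlePoint c r α) (circlePoint c r β))
      (segment ℝ (circlePoint c r γ) (circlePoint c r δ)) := by
  apply disjoint_segment_of_cross
  exact mul_pos (cross_pos hr h1 h2 (by linarith)) (cross_pos hr h1 (by linarith) h4)

end BottleneckMatching

namespace RealRAM

/-! ### Running programs -/

/-- The program contains no loop. -/
def Program.LoopFree : Program → Prop
  | .nop => True
  | .setNat _ _ _ => True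
  | .setReal _ _ _ => True
  | .seq c d => c.LoopFree ∧ d.LoopFree
  | .ite _ c d => c.LoopFree ∧ d.LoopFree
  | .loop _ _ => False

/-- An upper bound for the number of steps of a program without loops. -/
def Program.maxCost : Program → ℕ
  | .nop => 1
  | .setNat _ i e => i.cost + e.cost + 1
  | .setReal _ i e => i.cost + e.cost + 1
  | .seq c d => c.maxCost + d.maxCost
  | .ite b c d => b.cost + (c.maxCost + d.maxCost) + 1
  | .loop _ _ => 0

open Classical in
/-- The final state of a program without loops. -/
noncomputable def Program.run : Program → State → State
  | .nop, s => s
  | .setNat a i e, s => s.setNat a (i.eval s) (e.eval s)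
  | .setReal a i e, s => s.setReal a (i.eval s) (e.eval s)
  | .seq c d, s => d.run (c.run s)
  | .ite b c d, s => if b.eval s then c.run s else d.run s
  | .loop _ _, s => s

theorem Program.LoopFree.exec {c : Program} (hc : c.LoopFree) (s : State) :
    ∃ t ≤ c.maxCost, Exec c s (c.run s) t := by
  induction c generalizing s with
  | nop => exact ⟨1, le_rfl, .nop s⟩
  | setNat a i e => exact ⟨_, le_rfl, .setNat s a i e⟩
  | setReal a i e => exact ⟨_, le_rfl, .setReal s a i e⟩
  | seq c d ihc ihd =>
    obtain ⟨t, ht, h1⟩ := ihc hc.1 s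
    obtain ⟨u, hu, h2⟩ := ihd hc.2 (c.run s)
    exact ⟨t + u, Nat.add_le_add ht hu, .seq h1 h2⟩
  | ite b c d ihc ihd =>
    by_cases hb : b.eval s
    · obtain ⟨t, ht, h1⟩ := ihc hc.1 s
      refine ⟨b.cost + t + 1, by simp only [maxCost]; omega, ?_⟩
      rw [run, if_pos hb]; exact .iteTrue hb h1
    · obtain ⟨t, ht, h1⟩ := ihd hc.2 s
      refine ⟨b.cost + t + 1, by simp only [maxCost]; omega, ?_⟩
      rw [run, if_neg hb]; exact .iteFalse hb h1
  | loop => exact hc.elim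

/-- A loop that runs exactly `N` times, with an invariant `P`. -/
theorem exec_loop {b : Test} {c : Program} (hc : c.LoopFree) {N : ℕ} {P : ℕ → State → Prop}
    (hstep : ∀ i s, i < N → P i s → b.eval s ∧ P (i + 1) (c.run s))
    (hhalt : ∀ s, P N s → ¬ b.eval s) {s : State} (hs : P 0 s) :
    ∃ s' t, Exec (.loop b c) s s' t ∧ t ≤ (b.cost + c.maxCost + 1) * (N + 1) ∧ P N s' := by
  suffices H : ∀ k i s, i + k = N → P i s → ∃ s' t, Exec (.loop b c) s s' t ∧
      t ≤ (b.cost + c.maxCost + 1) * (k + 1) ∧ P N s' from H N 0 s (by omega) hs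
  intro k
  induction k with
  | zero =>
    intro i s hi h
    obtain rfl : i = N := by omega
    exact ⟨s, _, .loopStop (hhalt s h), by omega, h⟩
  | succ k ih =>
    intro i s hi h
    obtain ⟨hb, hP⟩ := hstep i s (by omega) h
    obtain ⟨t, ht, h1⟩ := hc.exec s
    obtain ⟨s', u, h2, hu, h3⟩ := ih (i + 1) _ (by omega) hP
    exact ⟨s', _, .loopStep hb h1 h2, by rw [Nat.mul_succ]; omega, h3⟩

end RealRAM

namespace BottleneckMatching
open RealRAM

/-! ### The program

Arrays of natural numbers: `0` number of points, `1` colors, `2` output, `3` current point,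
`4` current height, `5` levels, `6` last point of each level, `7` preceding point of the same
level, `8` and `9` bounds for the threshold.  Arrays of real numbers: `0` and `1` coordinates,
`2` and `3` squared length of the longest red-to-blue and blue-to-red arc of each level. -/

/-- The first cell of an array. -/
def var (a : ℕ) : NExp := .get a (.lit 0)

def isRed (e : NExp) : Test := .natEq (.get 1 e) (.lit 1)

def moreToDo : Test := .natLt (var 3) (var 0)

def nextPoint : Program := .setNat 3 (.lit 0) (.succ (var 3))

def rewind : Program := .setNat 3 (.lit 0) (.lit 0)

/-- The level of the current point. -/
def curLevel : NExp := .get 5 (var 3)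

/-- The predecessor of the current point. -/
def curPrv : NExp := .get 7 (var 3)

def levelBody : Program :=
  .seq (.ite (isRed (var 3))
    (.seq (.setNat 5 (var 3) (var 4)) (.setNat 4 (.lit 0) (.succ (var 4))))
    (.seq (.setNat 4 (.lit 0) (.pred (var 4))) (.setNat 5 (var 3) (var 4))))
  (.seq (.setNat 7 (var 3) (.get 6 curLevel))
  (.seq (.setNat 6 curLevel (var 3))
  (.seq (.setNat 9 (.lit 0) (.succ (var 9))) nextPoint)))

def coordDiff (a : ℕ) : RExp := .sub (.get a (var 3)) (.get a curPrv)

/-- The squared distance of the current point and its predecessor. -/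
def distSq : RExp :=
  .add (.mul (coordDiff 0) (coordDiff 0)) (.mul (coordDiff 1) (coordDiff 1))

def updateMax (a : ℕ) : Program :=
  .ite (.realLt (.get a curLevel) distSq) (.setReal a curLevel distSq) .nop

def costBody : Program :=
  .seq (.ite (isRed curPrv) (updateMax 2) (updateMax 3)) nextPoint

def thresholdBody : Program :=
  .ite (.realLt (.get 2 (.pred (var 9))) (.get 3 (var 8)))
    (.setNat 9 (.lit 0) (.pred (var 9))) (.setNat 8 (.lit 0) (.succ (var 8)))

def record : Program := .seq (.setNat 2 (var 3) curPrv) (.setNat 2 curPrv (var 3))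

def outputBody : Program :=
  .seq (.ite (.natLt curLevel (var 8)) (.ite (isRed curPrv) .nop record)
    (.ite (isRed curPrv) record .nop)) nextPoint

def bottleneckProgram : Program :=
  .seq (.setNat 4 (.lit 0) (var 0))
  (.seq (.loop moreToDo levelBody)
  (.seq rewind
  (.seq (.loop moreToDo levelBody)
  (.seq rewind
  (.seq (.loop moreToDo costBody)
  (.seq (.loop (.natLt (var 8) (var 9)) thresholdBody)
  (.seq rewind
  (.loop moreToDo outputBody))))))))

/-- The state holds the input. -/
structure HoldsInput (N : ℕ) (col : ℕ → Bool) (X Y : ℕ → ℝ) (s : State) : Prop where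
  size : s.nat 0 0 = N
  color : ∀ i < N, s.nat 1 i = if col i then 1 else 0
  x : ∀ i < N, s.real 0 i = X i
  y : ∀ i < N, s.real 1 i = Y i

/-! ### Loop invariants -/

variable {N : ℕ} {col : ℕ → Bool} {X Y : ℕ → ℝ}

theorem HoldsInput.of_eq {s s' : State} (h : HoldsInput N col X Y s)
    (h0 : s'.nat 0 = s.nat 0) (h1 : s'.nat 1 = s.nat 1) (h2 : s'.real 0 = s.real 0)
    (h3 : s'.real 1 = s.real 1) : HoldsInput N col X Y s' :=
  ⟨by rw [h0, h.size], by rw [h1]; exact h.color, by rw [h2]; exact h.x, by rw [h3]; exact h.y⟩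

/-- Invariant of the computation of levels and predecessors; `r` is the total number of points
visited so far, `i` the number of points visited in this round. -/
structure LevelInv (N : ℕ) (col : ℕ → Bool) (X Y : ℕ → ℝ) (r i : ℕ) (s : State) : Prop where
  input : HoldsInput N col X Y s
  cur : s.nat 3 0 = i
  height : s.nat 4 0 = height N col r
  last : ∀ k, s.nat 6 k = lastAt N col r k
  level : ∀ j < i, s.nat 5 j = level N col (r - i + j)
  prv : ∀ j < i, s.nat 7 j = lastAt N col (r - i + j) (BottleneckMatching.level N col (r - i + j))
  lo : s.nat 8 0 = 0
  hi : s.nat 9 0 = r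
  costs : s.real 2 = 0 ∧ s.real 3 = 0

/-- This serves both rounds, with `r = i` and then `r = N + i`. Only in the second round has every
level been seen before, so that the stored predecessors are the cyclic ones. -/
theorem LevelInv.step {r i : ℕ} {s : State} (h : LevelInv N col X Y r i s) (hi : i < N)
    (hr : r % N = i) (hir : i ≤ r) (hcol : col r = col i) :
    LevelInv N col X Y (r + 1) (i + 1) (levelBody.run s) := by
  have hc := h.input.color i hi
  have e1 : r + 1 - (i + 1) = r - i := by omega
  have e2 : r - i + i = r := by omega
  have h1 := h.cur
  have h2 := h.height
  have hb : (isRed (var 3)).eval s ↔ col r = true := by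
    simp only [isRed, var, Test.eval, NExp.eval, h1, hc, hcol]
    rcases col i <;> simp
  simp only [var] at hb
  have key : (levelBody.run s).nat 0 = s.nat 0 ∧ (levelBody.run s).nat 1 = s.nat 1 ∧
      (levelBody.run s).real = s.real ∧ (levelBody.run s).nat 3 0 = i + 1 ∧
      (levelBody.run s).nat 4 0 = BottleneckMatching.height N col (r + 1) ∧
      (levelBody.run s).nat 5 = Function.update (s.nat 5) i (BottleneckMatching.level N col r) ∧
      (levelBody.run s).nat 6 =
        Function.update (s.nat 6) (BottleneckMatching.level N col r) i ∧
      (levelBody.run s).nat 7 =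
        Function.update (s.nat 7) i (s.nat 6 (BottleneckMatching.level N col r)) ∧
      (levelBody.run s).nat 8 = s.nat 8 ∧ (levelBody.run s).nat 9 0 = s.nat 9 0 + 1 := by
    rcases hcr : col r <;> rw [hcr] at hb <;>
    simp [levelBody, Program.run, hb, nextPoint, curLevel, var, NExp.eval, State.setNat, h1, h2,
      BottleneckMatching.height, BottleneckMatching.level, hcr]
  obtain ⟨k0, k1, k2, k3, k4, k5, k6, k7, k8, k9⟩ := key
  refine ⟨h.input.of_eq k0 k1 (by rw [k2]) (by rw [k2]), k3, k4, fun k => ?_, fun j hj => ?_,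
    fun j hj => ?_, by rw [k8, h.lo], by rw [k9, h.hi], by rw [k2]; exact h.costs⟩
  · rw [k6, lastAt, hr, Function.update_apply, Function.update_apply, h.last]
  · rw [k5, e1, Function.update_apply]
    split
    · subst j; rw [e2]
    · exact h.level j (by omega)
  · rw [k7, e1, Function.update_apply]
    split
    · subst j; rw [e2, h.last]
    · exact h.prv j (by omega)

/-- The squared distance of `i` and its predecessor. -/
def gap (N : ℕ) (col : ℕ → Bool) (X Y : ℕ → ℝ) (i : ℕ) : ℝ :=
  (X i - X (prv N col i)) * (X i - X (prv N col i)) +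
    (Y i - Y (prv N col i)) * (Y i - Y (prv N col i))

/-- The state holds the input, the levels and the predecessors. -/
structure HoldsPrv (N : ℕ) (col : ℕ → Bool) (X Y : ℕ → ℝ) (s : State) : Prop where
  input : HoldsInput N col X Y s
  level : ∀ j < N, s.nat 5 j = level N col (N + j)
  prv : ∀ j < N, s.nat 7 j = prv N col j
  prv_lt : ∀ j < N, BottleneckMatching.prv N col j < N

theorem HoldsPrv.of_eq {s s' : State} (h : HoldsPrv N col X Y s)
    (h0 : s'.nat 0 = s.nat 0) (h1 : s'.nat 1 = s.nat 1) (h2 : s'.real 0 = s.real 0)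
    (h3 : s'.real 1 = s.real 1) (h5 : s'.nat 5 = s.nat 5) (h7 : s'.nat 7 = s.nat 7) :
    HoldsPrv N col X Y s' :=
  ⟨h.input.of_eq h0 h1 h2 h3, by rw [h5]; exact h.level, by rw [h7]; exact h.prv, h.prv_lt⟩

theorem HoldsPrv.eval_isRed {s : State} (h : HoldsPrv N col X Y s) {i : ℕ} (hi : i < N)
    (hs : s.nat 3 0 = i) : (isRed curPrv).eval s ↔ col (BottleneckMatching.prv N col i) = true := by
  simp only [isRed, curPrv, var, Test.eval, NExp.eval, hs, h.prv i hi,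
    h.input.color _ (h.prv_lt i hi)]
  rcases col (BottleneckMatching.prv N col i) <;> simp

theorem HoldsPrv.eval_distSq {s : State} (h : HoldsPrv N col X Y s) {i : ℕ} (hi : i < N)
    (hs : s.nat 3 0 = i) : distSq.eval s = gap N col X Y i := by
  simp only [distSq, coordDiff, curPrv, var, RExp.eval, NExp.eval, hs, h.prv i hi,
    h.input.x _ (h.prv_lt i hi), h.input.x i hi, h.input.y _ (h.prv_lt i hi), h.input.y i hi, gap]

/-- Invariant of the computation of the costs of the levels. -/
structure CostInv (N : ℕ) (col : ℕ → Bool) (X Y : ℕ → ℝ) (i : ℕ) (s : State) : Prop where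
  held : HoldsPrv N col X Y s
  cur : s.nat 3 0 = i
  lo : s.nat 8 0 = 0
  hi : s.nat 9 0 = 2 * N
  up : ∀ k B, 0 ≤ B → (s.real 2 k ≤ B ↔ ∀ j < i, level N col (N + j) = k →
    col (prv N col j) = true → gap N col X Y j ≤ B)
  down : ∀ k B, 0 ≤ B → (s.real 3 k ≤ B ↔ ∀ j < i, level N col (N + j) = k →
    col (prv N col j) = false → gap N col X Y j ≤ B)

theorem run_updateMax {s : State} (a : ℕ) :
    (updateMax a).run s = { s with real := Function.update s.real a (Function.update (s.real a)
      (curLevel.eval s) (max (s.real a (curLevel.eval s)) (distSq.eval s))) } := by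
  by_cases hlt : s.real a (curLevel.eval s) < distSq.eval s
  · rw [max_eq_right hlt.le]
    exact if_pos (c := Test.eval s (.realLt (.get a curLevel) distSq)) hlt
  · rw [max_eq_left (not_lt.1 hlt), Function.update_eq_self, Function.update_eq_self]
    exact if_neg (c := Test.eval s (.realLt (.get a curLevel) distSq)) hlt

theorem CostInv.step {i : ℕ} {s : State} (h : CostInv N col X Y i s) (hi : i < N) :
    CostInv N col X Y (i + 1) (costBody.run s) := by
  have h1 := h.cur
  have hlev : curLevel.eval s = level N col (N + i) := by
    simp only [curLevel, var, NExp.eval, h1, h.held.level i hi]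
  have hred := h.held.eval_isRed hi h1
  rcases hp : col (prv N col i) with - | -
  all_goals
    rw [hp] at hred
    have key : (costBody.run s).nat = (nextPoint.run s).nat := by
      simp [costBody, Program.run, hred, run_updateMax, nextPoint, var, NExp.eval, State.setNat]
    have keyR : (costBody.run s).real = ((updateMax (if col (prv N col i) then 2 else 3)).run s).real := by
      simp [costBody, Program.run, hred, hp, nextPoint, var, NExp.eval, State.setNat]
    rw [run_updateMax, hlev, h.held.eval_distSq hi h1, hp] at keyR
    simp only [nextPoint, Program.run, State.setNat, var, NExp.eval, h1] at key
    refine ⟨h.held.of_eq ?_ ?_ ?_ ?_ ?_ ?_, ?_, ?_, ?_, fun k B hB => ?_, fun k B hB => ?_⟩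
    iterate 9 simp [key, keyR, h.lo, h.hi]
    · rw [Nat.forall_lt_succ_right, ← h.up k B hB, keyR]
      by_cases hk : k = level N col (N + i) <;> simp [hp, hk, eq_comm]
    · rw [Nat.forall_lt_succ_right, ← h.down k B hB, keyR]
      by_cases hk : k = level N col (N + i) <;> simp [hp, hk, eq_comm]

/-- With the threshold `t`, no pair of the matching has squared length more than `B`. -/
def Good (N : ℕ) (col : ℕ → Bool) (X Y : ℕ → ℝ) (t : ℕ) (B : ℝ) : Prop :=
  ∀ i < N, Sel N col t i → gap N col X Y i ≤ B

/-- The cells start at `0` and so hold maxima that include `0`; the condition `0 ≤ B` makes this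
harmless, also for levels without points. -/
theorem good_iff {s : State} (h : CostInv N col X Y N s)
    (hlev : ∀ i < N, level N col (N + i) < 2 * N) {t : ℕ} {B : ℝ} (hB : 0 ≤ B) :
    Good N col X Y t B ↔
      (∀ k < t, s.real 3 k ≤ B) ∧ ∀ k < 2 * N, t ≤ k → s.real 2 k ≤ B := by
  simp only [h.up _ B hB, h.down _ B hB, Good, Sel]
  constructor
  · intro hg
    refine ⟨fun k hk j hj hjk hc => hg j hj ?_, fun k _ hk j hj hjk hc => hg j hj ?_⟩
    · simp [hjk, hk, hc]
    · simp [hjk, hk, hc]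
  · rintro ⟨h1, h2⟩ i hi hs
    by_cases ht : level N col (N + i) < t
    · exact h1 _ ht i hi rfl (hs.1 ht)
    · refine h2 _ (hlev i hi) (not_lt.1 ht) i hi rfl ?_
      simpa using mt hs.2 ht

/-- Invariant of the search for the threshold. -/
structure ThresholdInv (N : ℕ) (col : ℕ → Bool) (X Y : ℕ → ℝ) (U D : ℕ → ℝ) (i : ℕ)
    (s : State) : Prop where
  held : HoldsPrv N col X Y s
  up : s.real 2 = U
  down : s.real 3 = D
  le : s.nat 8 0 ≤ s.nat 9 0
  hi_le : s.nat 9 0 ≤ 2 * N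
  left : s.nat 9 0 - s.nat 8 0 + i = 2 * N
  best : ∀ B t, t ≤ 2 * N → ((∀ k < t, D k ≤ B) ∧ ∀ k < 2 * N, t ≤ k → U k ≤ B) →
    ∃ t', s.nat 8 0 ≤ t' ∧ t' ≤ s.nat 9 0 ∧
      ((∀ k < t', D k ≤ B) ∧ ∀ k < 2 * N, t' ≤ k → U k ≤ B)

/-- With candidates between `lo` and `hi`, threshold `hi` pays `D lo` and threshold `lo` pays `U (hi
- 1)`. The end that pays the larger of these two can be dropped: moving it inward by one adds only
the smaller one as a new cost. -/
theorem ThresholdInv.step {U D : ℕ → ℝ} {i : ℕ} {s : State}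
    (h : ThresholdInv N col X Y U D i s) (hi : i < 2 * N) :
    ThresholdInv N col X Y U D (i + 1) (thresholdBody.run s) := by
  obtain ⟨held, up, down, le, hi_le, left, best⟩ := h
  by_cases hlt : U (s.nat 9 0 - 1) < D (s.nat 8 0)
  · have e : thresholdBody.run s = s.setNat 9 0 (s.nat 9 0 - 1) := by
      simp [thresholdBody, Program.run, Test.eval, RExp.eval, NExp.eval, var, up, down, hlt]
    have e8 : (thresholdBody.run s).nat 8 0 = s.nat 8 0 := by rw [e]; simp [State.setNat]
    have e9 : (thresholdBody.run s).nat 9 0 = s.nat 9 0 - 1 := by rw [e]; simp [State.setNat]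
    refine ⟨held.of_eq ?_ ?_ ?_ ?_ ?_ ?_, ?_, ?_, ?_, ?_, ?_, ?_⟩
    iterate 8 simp [e, State.setNat, up, down]
    · omega
    · omega
    · omega
    · rw [e8, e9]
      intro B t ht hB
      obtain ⟨t', h1, h2, h3, h4⟩ := best B t ht hB
      -- Only the dropped threshold `hi` needs a substitute, namely `hi - 1`; its new cost `U (hi -
      -- 1)` is below `D lo ≤ B`.
      rcases h2.eq_or_lt with he | hl
      · refine ⟨t' - 1, by omega, by omega, fun k hk => h3 k (by omega), fun k hk hk' => ?_⟩
        by_cases hkt : t' ≤ k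
        · exact h4 k hk hkt
        · have h5 := h3 (s.nat 8 0) (by omega)
          have h6 : k = s.nat 9 0 - 1 := by omega
          rw [h6]; linarith
      · exact ⟨t', h1, by omega, h3, h4⟩
  · have e : thresholdBody.run s = s.setNat 8 0 (s.nat 8 0 + 1) := by
      simp [thresholdBody, Program.run, Test.eval, RExp.eval, NExp.eval, var, up, down, hlt]
    have e8 : (thresholdBody.run s).nat 8 0 = s.nat 8 0 + 1 := by rw [e]; simp [State.setNat]
    have e9 : (thresholdBody.run s).nat 9 0 = s.nat 9 0 := by rw [e]; simp [State.setNat]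
    refine ⟨held.of_eq ?_ ?_ ?_ ?_ ?_ ?_, ?_, ?_, ?_, ?_, ?_, ?_⟩
    iterate 8 simp [e, State.setNat, up, down]
    · omega
    · omega
    · omega
    · rw [e8, e9]
      intro B t ht hB
      obtain ⟨t', h1, h2, h3, h4⟩ := best B t ht hB
      -- Here `lo` is replaced by `lo + 1`, whose new cost satisfies `D lo ≤ U (hi - 1) ≤ B`.
      rcases h1.eq_or_lt with he | hl
      · refine ⟨t' + 1, by omega, by omega, fun k hk => ?_, fun k hk hk' => h4 k hk (by omega)⟩
        by_cases hkt : k < t'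
        · exact h3 k hkt
        · have h5 := h4 (s.nat 9 0 - 1) (by omega) (by omega)
          have h6 : k = s.nat 8 0 := by omega
          rw [h6]; linarith
      · exact ⟨t', by omega, h2, h3, h4⟩

/-- Invariant of the output of the matching with threshold `t`. -/
structure OutputInv (N : ℕ) (col : ℕ → Bool) (X Y : ℕ → ℝ) (t i : ℕ) (s : State) : Prop where
  held : HoldsPrv N col X Y s
  cur : s.nat 3 0 = i
  threshold : s.nat 8 0 = t
  out : ∀ j < i, Sel N col t j → s.nat 2 j = prv N col j ∧ s.nat 2 (prv N col j) = j

/-- Selected pairs share no point, by `hsel` and `hinj`, so recording a pair does not overwrite an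
earlier one. -/
theorem OutputInv.step {t i : ℕ} {s : State} (h : OutputInv N col X Y t i s) (hi : i < N)
    (hsel : ∀ j < N, Sel N col t j → ¬ Sel N col t (prv N col j))
    (hinj : ∀ j < N, ∀ k < N, prv N col j = prv N col k → j = k) :
    OutputInv N col X Y t (i + 1) (outputBody.run s) := by
  have h1 := h.cur
  have hlev : curLevel.eval s = level N col (N + i) := by
    simp only [curLevel, var, NExp.eval, h1, h.held.level i hi]
  have hprv : curPrv.eval s = prv N col i := by
    simp only [curPrv, var, NExp.eval, h1, h.held.prv i hi]
  have hred := h.held.eval_isRed hi h1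
  have ht : (var 8).eval s = t := by simp [var, NExp.eval, h.threshold]
  by_cases hs : Sel N col t i
  · have e : outputBody.run s = nextPoint.run (record.run s) := by
      by_cases hl : level N col (N + i) < t
      · have := hs.1 hl
        simp [outputBody, Program.run, Test.eval, hlev, ht, hl, hred, this]
      · have := mt hs.2 hl
        simp [outputBody, Program.run, Test.eval, hlev, ht, hl, hred, this]
    have e2 : (outputBody.run s).nat 2 =
        Function.update (Function.update (s.nat 2) i (prv N col i)) (prv N col i) i := by
      rw [e]
      simp [nextPoint, record, Program.run, State.setNat, var, NExp.eval, h1, curPrv,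
        h.held.prv i hi]
    refine ⟨h.held.of_eq ?_ ?_ ?_ ?_ ?_ ?_, ?_, ?_, fun j hj hsj => ?_⟩
    iterate 8
      rw [e]; simp [nextPoint, record, Program.run, State.setNat, var, NExp.eval, h1, h.threshold]
    rw [e2]
    have hip : i ≠ prv N col i := fun he => by
      have := hsel i hi hs; rw [← he] at this; exact this hs
    rcases Nat.lt_succ_iff_lt_or_eq.1 hj with hji | rfl
    · have n1 : j ≠ prv N col i := fun he => hsel i hi hs (he ▸ hsj)
      have n2 : prv N col j ≠ prv N col i := fun he => by
        have := hinj j (by omega) i hi he; omega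
      have n3 : prv N col j ≠ i := fun he => by
        have := hsel j (by omega) hsj; rw [he] at this; exact this hs
      have n4 : j ≠ i := by omega
      simpa [Function.update_apply, n1, n2, n3, n4] using h.out j hji hsj
    · simp [hip]
  · have e : outputBody.run s = nextPoint.run s := by
      by_cases hl : level N col (N + i) < t
      · have : ¬ col (prv N col i) = false := fun hc => hs ⟨fun _ => hc, fun _ => hl⟩
        simp at this
        simp [outputBody, Program.run, Test.eval, hlev, ht, hl, hred, this]
      · have : ¬ col (prv N col i) = true := fun hc => hs (by simp [Sel, hl, hc])
        simp at this
        simp [outputBody, Program.run, Test.eval, hlev, ht, hl, hred, this]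
    refine ⟨h.held.of_eq ?_ ?_ ?_ ?_ ?_ ?_, ?_, ?_, fun j hj hsj => ?_⟩
    iterate 8
      rw [e]; simp [nextPoint, Program.run, State.setNat, var, NExp.eval, h1, h.threshold]
    rcases Nat.lt_succ_iff_lt_or_eq.1 hj with hji | rfl
    · simpa [e, nextPoint, Program.run, State.setNat] using h.out j hji hsj
    · exact absurd hsj hs

end BottleneckMatching

/-! ### Running time and correctness of the whole program -/

namespace BottleneckMatching
open RealRAM

variable {N : ℕ} {col : ℕ → Bool} {X Y : ℕ → ℝ}

/-- A bound for the number of steps per point. -/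
def stepBound : ℕ :=
  13 + 2 * (moreToDo.cost + levelBody.maxCost + 1) + (moreToDo.cost + costBody.maxCost + 1) +
    2 * ((Test.natLt (var 8) (var 9)).cost + thresholdBody.maxCost + 1) +
    (moreToDo.cost + outputBody.maxCost + 1)

theorem HoldsInput.eval_moreToDo {s : State} (h : HoldsInput N col X Y s) {i : ℕ}
    (hs : s.nat 3 0 = i) : moreToDo.eval s ↔ i < N := by
  simp [moreToDo, var, Test.eval, NExp.eval, hs, h.size]

/-- The program computes the matching whose threshold is optimal. -/
theorem exec_bottleneckProgram (hcyc : 0 < N → Cyclic N col) {s₀ : State}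
    (hin : HoldsInput N col X Y s₀) (hnat : ∀ a, 2 ≤ a → s₀.nat a = 0)
    (hreal : ∀ a, 2 ≤ a → s₀.real a = 0) :
    ∃ s t T, Exec bottleneckProgram s₀ s t ∧ t ≤ stepBound * (N + 1) ∧
      (∀ i < N, Sel N col T i → s.nat 2 i = prv N col i ∧ s.nat 2 (prv N col i) = i) ∧
      ∀ B t', 0 ≤ B → t' ≤ 2 * N → Good N col X Y t' B → Good N col X Y T B := by
  have hc : ∀ i < N, Cyclic N col := fun i hi => hcyc (by omega)
  have exec_set : ∀ (a : ℕ) (e : NExp) (s : State),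
      Exec (.setNat a (.lit 0) e) s (s.setNat a 0 (e.eval s)) (1 + e.cost + 1) :=
    fun a e s => .setNat s a (.lit 0) e
  -- initial height
  have x0 := exec_set 4 (var 0) s₀
  have i0 : LevelInv N col X Y 0 0 (s₀.setNat 4 0 ((var 0).eval s₀)) := by
    refine ⟨hin.of_eq ?_ ?_ ?_ ?_, ?_, ?_, ?_, ?_, ?_, ?_, ?_, ?_, ?_⟩ <;>
      simp [State.setNat, hnat, hreal, var, NExp.eval, hin.size, height, lastAt]
  obtain ⟨s₁, t₁, x1, b1, i1⟩ := exec_loop (b := moreToDo) (c := levelBody)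
    (by simp [levelBody, Program.LoopFree, nextPoint]) (N := N)
    (P := fun i => LevelInv N col X Y i i)
    (fun i s hi h => ⟨(h.input.eval_moreToDo h.cur).2 hi,
      h.step hi (Nat.mod_eq_of_lt hi) le_rfl rfl⟩)
    (fun s h => by simp [h.input.eval_moreToDo h.cur]) i0
  have x1' := exec_set 3 (.lit 0) s₁
  have i1' : LevelInv N col X Y N 0 (s₁.setNat 3 0 ((NExp.lit 0).eval s₁)) := by
    refine ⟨i1.input.of_eq ?_ ?_ ?_ ?_, ?_, ?_, ?_, ?_, ?_, ?_, ?_, ?_, ?_⟩ <;>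
      simp [State.setNat, i1.height, i1.last, i1.lo, i1.hi, i1.costs, NExp.eval]
  obtain ⟨s₂, t₂, x2, b2, i2⟩ := exec_loop (b := moreToDo) (c := levelBody)
    (by simp [levelBody, Program.LoopFree, nextPoint]) (N := N)
    (P := fun i => LevelInv N col X Y (N + i) i)
    (fun i s hi h => ⟨(h.input.eval_moreToDo h.cur).2 hi,
      h.step hi (by simp [Nat.mod_eq_of_lt hi]) (by omega)
        (by simpa [add_comm] using (hc i hi).periodic i)⟩)
    (fun s h => by simp [h.input.eval_moreToDo h.cur]) i1'
  have x2' := exec_set 3 (.lit 0) s₂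
  have i2' : CostInv N col X Y 0 (s₂.setNat 3 0 ((NExp.lit 0).eval s₂)) := by
    have hl := i2.level
    have hp := i2.prv
    simp only [Nat.add_sub_cancel] at hl hp
    refine ⟨⟨i2.input.of_eq ?_ ?_ ?_ ?_, fun j hj => ?_, fun j hj => ?_, fun j hj =>
      prv_lt (hc j hj) j⟩, ?_, ?_, ?_, fun k B hB => ?_, fun k B hB => ?_⟩
    iterate 4 simp [State.setNat]
    · simpa [State.setNat] using hl j hj
    · simpa [State.setNat, prv] using hp j hj
    iterate 5 simp [State.setNat, i2.lo, i2.hi, i2.costs, NExp.eval, two_mul, *]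
  obtain ⟨s₃, t₃, x3, b3, i3⟩ := exec_loop (b := moreToDo) (c := costBody)
    (by simp [costBody, updateMax, Program.LoopFree, nextPoint]) (N := N)
    (P := fun i => CostInv N col X Y i)
    (fun i s hi h => ⟨(h.held.input.eval_moreToDo h.cur).2 hi, h.step hi⟩)
    (fun s h => by simp [h.held.input.eval_moreToDo h.cur]) i2'
  have i3' : ThresholdInv N col X Y (s₃.real 2) (s₃.real 3) 0 s₃ :=
    ⟨i3.held, rfl, rfl, by rw [i3.lo]; omega, by rw [i3.hi], by rw [i3.lo, i3.hi]; omega,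
      fun B t ht hB => ⟨t, by rw [i3.lo]; omega, by rw [i3.hi]; omega, hB⟩⟩
  obtain ⟨s₄, t₄, x4, b4, i4⟩ := exec_loop (b := .natLt (var 8) (var 9)) (c := thresholdBody)
    (by simp [thresholdBody, Program.LoopFree]) (N := 2 * N)
    (P := fun i => ThresholdInv N col X Y (s₃.real 2) (s₃.real 3) i)
    (fun i s hi h => ⟨by have := h.left; simp only [Test.eval, var, NExp.eval]; omega, h.step hi⟩)
    (fun s h => by have := h.left; have := h.le; simp only [Test.eval, var, NExp.eval]; omega) i3'
  have x4' := exec_set 3 (.lit 0) s₄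
  have i4' : OutputInv N col X Y (s₄.nat 8 0) 0 (s₄.setNat 3 0 ((NExp.lit 0).eval s₄)) := by
    refine ⟨i4.held.of_eq ?_ ?_ ?_ ?_ ?_ ?_, ?_, ?_, ?_⟩ <;> simp [State.setNat, NExp.eval]
  obtain ⟨s₅, t₅, x5, b5, i5⟩ := exec_loop (b := moreToDo) (c := outputBody)
    (by simp [outputBody, record, Program.LoopFree, nextPoint]) (N := N)
    (P := fun i => OutputInv N col X Y (s₄.nat 8 0) i)
    (fun i s hi h => ⟨(h.held.input.eval_moreToDo h.cur).2 hi,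
      h.step hi (fun j hj hs => by rw [sel_prv (hc j hj)]; exact not_not.2 hs)
        fun j hj k hk he => prv_injOn (hc j hj) hj hk he⟩)
    (fun s h => by simp [h.held.input.eval_moreToDo h.cur]) i4'
  refine ⟨s₅, _, s₄.nat 8 0, .seq x0 (.seq x1 (.seq x1' (.seq x2 (.seq x2' (.seq x3 (.seq x4
    (.seq x4' x5))))))), ?_, i5.out, fun B t' hB ht' hg => ?_⟩
  -- The threshold loop runs `2 * N` times, once for each level. The constant `13` pays for the
  -- initial height (4 steps) and the three rewinds (3 steps each).
  · have b4' := b4.trans (Nat.mul_le_mul_left _ (show 2 * N + 1 ≤ 2 * (N + 1) by omega))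
    have h13 : 13 ≤ 13 * (N + 1) := by omega
    rw [stepBound]
    simp only [add_mul] at *
    simp only [NExp.cost, var] at *
    nlinarith
  · have hlev : ∀ i < N, level N col (N + i) < 2 * N := fun i hi => (hc i hi).level_lt _
    obtain ⟨t'', h1, h2, h3⟩ := i4.best B t' ht' ((good_iff i3 hlev hB).1 hg)
    have h4 := i4.left
    have : t'' = s₄.nat 8 0 := by omega
    subst this
    exact (good_iff i3 hlev hB).2 h3

end BottleneckMatching

namespace BottleneckMatching

/-! ### Non-crossing matchings of points on a circle -/

/-- `Θ` lists the angles of `N` points on a circle, in counterclockwise order, periodically. -/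
structure Angles (N : ℕ) (Θ : ℕ → ℝ) : Prop where
  mono : StrictMono Θ
  period : ∀ i, Θ (i + N) = Θ i + 2 * Real.pi

variable {N : ℕ} {col : ℕ → Bool} {X Y : ℕ → ℝ} {Θ : ℕ → ℝ}
  {c : EuclideanSpace ℝ (Fin 2)} {r : ℝ}

theorem Angles.lt_add (hΘ : Angles N Θ) {i j : ℕ} (h : j < i + N) : Θ j < Θ i + 2 * Real.pi := by
  rw [← hΘ.period]; exact hΘ.mono h

theorem Angles.circlePoint_add (hΘ : Angles N Θ) (i : ℕ) :
    circlePoint c r (Θ (i + N)) = circlePoint c r (Θ i) := by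
  simp [circlePoint, hΘ.period]

theorem Angles.circlePoint_add_mul (hΘ : Angles N Θ) (i a : ℕ) :
    circlePoint c r (Θ (i + N * a)) = circlePoint c r (Θ i) := by
  induction a with
  | zero => simp
  | succ a ih => rw [Nat.mul_succ, ← add_assoc, hΘ.circlePoint_add, ih]

theorem Angles.circlePoint_mod (hΘ : Angles N Θ) (i : ℕ) :
    circlePoint c r (Θ (i % N)) = circlePoint c r (Θ i) := by
  conv_rhs => rw [← Nat.mod_add_div i N, hΘ.circlePoint_add_mul]

/-- Either `z` begins inside the first arc, or the arcs are separated, or the second arc reaches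
past `y + N` and contains the next copy of the first. Shared endpoints are excluded by
`Excursion.right_ne_left`. -/
theorem Excursion.disjoint (h : Cyclic N col) (hΘ : Angles N Θ) (hr : 0 < r) {t y x z w : ℕ}
    (hc : Excursion N col t y x) (hd : Excursion N col t z w) (h1 : y < z) (h2 : z < y + N) :
    Disjoint (segment ℝ (circlePoint c r (Θ y)) (circlePoint c r (Θ x)))
      (segment ℝ (circlePoint c r (Θ z)) (circlePoint c r (Θ w))) := by
  have hw := hd.1.lt_add h
  have hzw := hd.1.1
  have hc' := hc.add_mul h 1
  rw [mul_one] at hc'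
  rcases lt_trichotomy z x with hl | rfl | hl
  · exact disjoint_of_nested hr (hΘ.mono h1) (hΘ.mono hzw) (hΘ.mono (hc.nested h hd h1 hl))
      (hΘ.lt_add (hc.1.lt_add h))
  · exact absurd hd (hc.right_ne_left h)
  · rcases lt_trichotomy w (y + N) with hl' | rfl | hl'
    · exact disjoint_of_separated hr (hΘ.mono hc.1.1) (hΘ.mono hl) (hΘ.mono hzw) (hΘ.lt_add hl')
    · exact absurd hc' (hd.right_ne_left h)
    · rw [← hΘ.circlePoint_add y, ← hΘ.circlePoint_add x]
      exact (disjoint_of_nested hr (hΘ.mono h2) (hΘ.mono hc'.1.1)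
        (hΘ.mono (hd.nested h hc' h2 hl')) (hΘ.lt_add hw)).symm

/-- No two segments of the matching with threshold `t` meet. -/
theorem Sel.disjoint (h : Cyclic N col) (hΘ : Angles N Θ) (hr : 0 < r) {t a b : ℕ}
    (ha : a < N) (hb : b < N) (hab : a ≠ b) (hsa : Sel N col t a) (hsb : Sel N col t b) :
    Disjoint (segment ℝ (circlePoint c r (Θ (prv N col a))) (circlePoint c r (Θ a)))
      (segment ℝ (circlePoint c r (Θ (prv N col b))) (circlePoint c r (Θ b))) := by
  obtain ⟨y, hy, hy'⟩ := hsa.excursion h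
  obtain ⟨z, hz, hz'⟩ := hsb.excursion h
  rw [hy', hz', hΘ.circlePoint_mod, hΘ.circlePoint_mod, ← hΘ.circlePoint_add a,
    ← hΘ.circlePoint_add b, add_comm a, add_comm b]
  have hyz : y % N ≠ z % N := by
    rw [← hy', ← hz']; exact fun he => hab (prv_injOn h ha hb he)
  -- The two beginnings differ by less than two periods, so at most one shift by `N` puts `z` within
  -- one period after `y`.
  have key : ∀ {y x z w : ℕ}, Excursion N col t y x → Excursion N col t z w → y % N ≠ z % N →
      y ≤ z → z < y + 2 * N → Disjoint (segment ℝ (circlePoint c r (Θ y)) (circlePoint c r (Θ x)))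
      (segment ℝ (circlePoint c r (Θ z)) (circlePoint c r (Θ w))) := by
    intro y x z w hy hz hne hle hlt
    rcases lt_or_ge z (y + N) with hl | hl
    · exact hy.disjoint h hΘ hr hz (lt_of_le_of_ne hle fun he => hne (by rw [he])) hl
    · have hy' := hy.add_mul h 1
      rw [mul_one] at hy'
      rw [← hΘ.circlePoint_add y, ← hΘ.circlePoint_add x]
      exact hy'.disjoint h hΘ hr hz (lt_of_le_of_ne hl fun he => hne (by rw [← he]; simp))
        (by omega)
  have h1 := hy.1.lt_add h
  have h2 := hz.1.lt_add h
  have h3 := hy.1.1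
  have h4 := hz.1.1
  rcases le_total y z with hle | hle
  · exact key hy hz hyz hle (by omega)
  · exact (key hz hy hyz.symm hle (by omega)).symm

/-- The circle can be cut at a place that is not covered by the short arcs of a matching. -/
theorem exists_cut (hΘ : Angles N Θ) {M : ℕ → ℕ} (hM : ∀ i < N, M i < N ∧ M (M i) = i)
    (hcross : ∀ p q, p < q → q < M p → M p < M q → M q < N → False) :
    ∃ g ≤ N, ∀ p < N, p < M p → (Real.pi < Θ (M p) - Θ p ↔ p < g ∧ g ≤ M p) := by
  classical
  let S := (Finset.range N).filter fun p => p < M p ∧ Real.pi < Θ (M p) - Θ p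
  have mem_S : ∀ p, p ∈ S ↔ p < N ∧ p < M p ∧ Real.pi < Θ (M p) - Θ p := by
    simp [S]
  by_cases hS : S.Nonempty
  · obtain ⟨p₀, hp₀, hmin⟩ := Finset.exists_min_image S (fun p => M p - p) hS
    obtain ⟨h1, h2, h3⟩ := (mem_S p₀).1 hp₀
    obtain ⟨h4, h5⟩ := hM p₀ h1
    -- The cut lies directly after the beginning of the long pair with fewest points. Two long arcs
    -- are never separated, as together they exceed a full turn; so by minimality and non-crossing
    -- every long arc contains that of `p₀`. Conversely, an arc over the cut contains that of `p₀`
    -- and hence is long.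
    refine ⟨p₀ + 1, by omega, fun p hp hpM => ?_⟩
    obtain ⟨h6, h7⟩ := hM p hp
    have hne : p ≠ p₀ → M p ≠ M p₀ := fun hne he => hne (by rw [← h7, he, h5])
    have hne' : M p ≠ p₀ := fun he => by rw [he] at h7; omega
    have hne'' : M p₀ ≠ p := fun he => by rw [he] at h5; omega
    constructor
    · intro hlong
      have hm := hmin p ((mem_S p).2 ⟨hp, hpM, hlong⟩)
      have s1 : ¬ M p < p₀ := fun hl => by
        have := hΘ.mono hl
        have := hΘ.lt_add (i := p) (j := M p₀) (by omega)
        linarith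
      have s2 : ¬ M p₀ < p := fun hl => by
        have := hΘ.mono hl
        have := hΘ.lt_add (i := p₀) (j := M p) (by omega)
        linarith
      by_cases hpp : p = p₀
      · omega
      · have := hne hpp
        have := hcross p₀ p
        by_cases hlt : p₀ < p
        · by_cases hMM : M p₀ < M p
          · exact (this hlt (by omega) hMM h6).elim
          · omega
        · omega
    · rintro ⟨h8, h9⟩
      rcases (Nat.lt_succ_iff.1 h8).eq_or_lt with rfl | hl
      · exact h3
      · have h10 := hcross p p₀ hl (by omega)
        have h11 := hne (by omega)
        have h12 : M p₀ < M p := by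
          by_contra! hge
          exact h10 (by omega) h4
        have := hΘ.mono hl
        have := hΘ.mono h12
        linarith
  · refine ⟨0, by omega, fun p hp hpM => ?_⟩
    have : ¬ Real.pi < Θ (M p) - Θ p := fun hlong => hS ⟨p, (mem_S p).2 ⟨hp, hpM, hlong⟩⟩
    simp [this]

/-- Every non-crossing matching is at least as long as the matching with a suitable threshold. -/
theorem exists_threshold (h : Cyclic N col) (hΘ : Angles N Θ) {M : ℕ → ℕ}
    (hM : ∀ i < N, M i < N ∧ M (M i) = i ∧ col (M i) ≠ col i)
    (hcross : ∀ p q p' q', p < q → q < p' → p' < q' → q' < p + N → p' % N = M (p % N) →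
      q' % N = M (q % N) → False) :
    ∃ t ≤ 2 * N, ∀ i < N, Sel N col t i → ∃ p < N,
      dist (circlePoint c r (Θ i)) (circlePoint c r (Θ (prv N col i))) ^ 2 ≤
        dist (circlePoint c r (Θ p)) (circlePoint c r (Θ (M p))) ^ 2 := by
  have hpos := h.pos
  obtain ⟨g, hg, hcut⟩ := exists_cut hΘ (M := M) (fun i hi => ⟨(hM i hi).1, (hM i hi).2.1⟩)
    (fun p q h1 h2 h3 h4 => hcross p q (M p) (M q) h1 h2 h3 (by omega)
      (by rw [Nat.mod_eq_of_lt (by omega), Nat.mod_eq_of_lt (by omega)])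
      (by rw [Nat.mod_eq_of_lt (by omega), Nat.mod_eq_of_lt (by omega)]))
  -- the matching, lifted to the window that begins at the cut
  let L : ℕ → ℕ := fun i => if M (i % N) < g then M (i % N) + N else M (i % N)
  have mod_inj : ∀ {a b : ℕ}, g ≤ a → a < g + N → g ≤ b → b < g + N → a % N = b % N → a = b := by
    intro a b h1 h2 h3 h4 he
    have e1 := Nat.mod_add_div a N
    have e2 := Nat.mod_add_div b N
    rcases lt_trichotomy (a / N) (b / N) with hl | hl | hl
    · have := Nat.mul_le_mul_left N (Nat.succ_le_of_lt hl); rw [Nat.mul_succ] at this; omega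
    · rw [hl] at e1; omega
    · have := Nat.mul_le_mul_left N (Nat.succ_le_of_lt hl); rw [Nat.mul_succ] at this; omega
  have hLmod : ∀ i, L i % N = M (i % N) := by
    intro i
    have := (hM _ (Nat.mod_lt i hpos)).1
    simp only [L]; split <;> simp [Nat.mod_eq_of_lt this]
  have hLwin : ∀ i, g ≤ L i ∧ L i < g + N := by
    intro i
    have := (hM _ (Nat.mod_lt i hpos)).1
    simp only [L]; split <;> omega
  -- The pairs separated by the cut are exactly those with index arc longer than `π`. In the window
  -- beginning at `g` they span the complementary arc; all others keep their arc.
  have hshort : ∀ i, g ≤ i → i < g + N → i < L i → Θ (L i) - Θ i ≤ Real.pi := by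
    intro i h1 h2 h3
    have hMi := hM _ (Nat.mod_lt i hpos)
    rcases lt_or_ge i N with hl | hl
    · have hi : i % N = i := Nat.mod_eq_of_lt hl
      simp only [L, hi] at h3 hMi ⊢
      split at h3
      · rename_i hlt
        rw [if_pos hlt, hΘ.period]
        have := (hcut (M i) hMi.1 (by rw [hMi.2.1]; omega)).2 (by rw [hMi.2.1]; omega)
        rw [hMi.2.1] at this
        linarith
      · rename_i hge
        rw [if_neg hge]
        have := (hcut i hl h3).not.2 (by omega)
        linarith
    · obtain ⟨j, rfl⟩ := Nat.exists_eq_add_of_le' hl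
      have hj : (j + N) % N = j := by rw [Nat.add_mod_right, Nat.mod_eq_of_lt (by omega)]
      simp only [L, hj] at h3 hMi ⊢
      split at h3
      · rename_i hlt
        rw [if_pos hlt, hΘ.period, hΘ.period]
        have := (hcut j (by omega) (by omega)).not.2 (by omega)
        linarith
      · omega
  refine ⟨height N col g, (h.height_lt g).le, fun i hi hs => ?_⟩
  obtain ⟨y, hy, hy'⟩ := hs.excursion h
  obtain ⟨x, hx⟩ : ∃ x, x = N + i := ⟨_, rfl⟩
  rw [← hx] at hy
  -- move the excursion into the window
  obtain ⟨y', x', hexc, hgy, hyg, ey, ex⟩ : ∃ y' x', Excursion N col (height N col g) y' x' ∧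
      g ≤ y' ∧ y' < g + N ∧ y' % N = y % N ∧ x' % N = x % N := by
    obtain ⟨y₀, x₀, he, h1, h2, h3⟩ := hy.exists_lt h
    rcases lt_or_ge y₀ g with hl | hl
    · have he' := he.add_mul h 1
      rw [mul_one] at he'
      exact ⟨y₀ + N, x₀ + N, he', by omega, by omega, by simpa using h2, by simpa using h3⟩
    · exact ⟨y₀, x₀, he, hl, by omega, h2, h3⟩
  -- The height at `g + N` is again the threshold, and an excursion avoids that height.
  have hxg : x' < g + N := by
    by_contra! hge
    exact hexc.height_ne h hyg hge (h.height_add g)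
  obtain ⟨p, hp1, hp2, hp3, hp4⟩ := exists_covering h (g := g) (M := L)
    (fun i h1 h2 => by
      have hMi := hM _ (Nat.mod_lt i hpos)
      refine ⟨(hLwin i).1, (hLwin i).2, mod_inj (hLwin _).1 (hLwin _).2 h1 h2 ?_, ?_⟩
      · rw [hLmod, hLmod, hMi.2.1]
      · rw [← h.col_mod (L i), hLmod, ← h.col_mod i]; exact hMi.2.2)
    (fun p q h1 h2 h3 h4 h5 => hcross p q (L p) (L q) h2 h3 h4 (by omega) (hLmod p) (hLmod q))
    hgy hexc.1.1 hxg (fun z h1 h2 => hexc.height_ne h h1 h2)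
  have hyx := hexc.1.1
  refine ⟨p % N, Nat.mod_lt _ hpos, ?_⟩
  rw [← hLmod, hΘ.circlePoint_mod, hΘ.circlePoint_mod, hy', ← ey, hΘ.circlePoint_mod,
    ← hΘ.circlePoint_add i, add_comm i, ← hx, ← hΘ.circlePoint_mod x, ← ex, hΘ.circlePoint_mod,
    dist_comm (circlePoint c r (Θ x'))]
  exact dist_circlePoint_le (hΘ.mono.monotone hp2) (hΘ.mono hyx).le (hΘ.mono.monotone hp3)
    (hshort p hp1 (by omega) (by omega))

end BottleneckMatching

namespace BottleneckMatching
open RealRAM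

/-! ### The main theorem -/

variable {n : ℕ}

/-- The colors, continued periodically. -/
def colorAt (red : Fin (2 * n) → Bool) (i : ℕ) : Bool :=
  if h : i % (2 * n) < 2 * n then red ⟨i % (2 * n), h⟩ else false

/-- The coordinates of the points. -/
noncomputable def coord (p : Fin (2 * n) → EuclideanSpace ℝ (Fin 2)) (k : Fin 2) (i : ℕ) : ℝ :=
  if h : i < 2 * n then p ⟨i, h⟩ k else 0

theorem colorAt_val (red : Fin (2 * n) → Bool) (i : Fin (2 * n)) : colorAt red i = red i := by
  simp [colorAt, Nat.mod_eq_of_lt i.2]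

theorem Balanced.cyclic {red : Fin (2 * n) → Bool} (h : Balanced red) (hn : 0 < 2 * n) :
    Cyclic (2 * n) (colorAt red) := by
  refine ⟨hn, fun r => by simp [colorAt], ?_⟩
  rw [← Fin.sum_univ_eq_sum_range]
  have e : ∀ i : Fin (2 * n), sgn (colorAt red) i = 2 * (if red i = true then 1 else 0) - 1 := by
    intro i
    rw [sgn, colorAt_val]; split <;> norm_num
  rw [Finset.sum_congr rfl fun i _ => e i, Finset.sum_sub_distrib, ← Finset.mul_sum,
    Finset.sum_boole, h]
  simp

theorem holdsInput_input (p : Fin (2 * n) → EuclideanSpace ℝ (Fin 2)) (red : Fin (2 * n) → Bool) :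
    HoldsInput (2 * n) (colorAt red) (coord p 0) (coord p 1) (input p red) := by
  refine ⟨by simp [input], fun i hi => ?_, fun i hi => ?_, fun i hi => ?_⟩
  · simp [input, colorAt, hi, Nat.mod_eq_of_lt hi]
  · simp [input, coord, hi]
  · simp [input, coord, hi]

/-- The angles are continued by adding a full turn per period; the bound `θ j < θ i + 2 * Real.pi`
keeps them increasing across the seam. -/
theorem OnCircle.exists_angles {p : Fin (2 * n) → EuclideanSpace ℝ (Fin 2)} (hp : OnCircle p)
    (hn : 0 < 2 * n) : ∃ (c : EuclideanSpace ℝ (Fin 2)) (r : ℝ) (Θ : ℕ → ℝ), 0 < r ∧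
      Angles (2 * n) Θ ∧ ∀ i : Fin (2 * n), p i = circlePoint c r (Θ i) := by
  obtain ⟨c, r, θ, hr, hmono, hlt, hp⟩ := hp
  refine ⟨c, r, fun i => θ ⟨i % (2 * n), Nat.mod_lt _ hn⟩ + (i / (2 * n) : ℕ) * (2 * Real.pi), hr,
    ⟨strictMono_nat_of_lt_succ fun i => ?_, fun i => ?_⟩, fun i => ?_⟩
  · rcases lt_or_ge (i % (2 * n) + 1) (2 * n) with hl | hl
    · obtain ⟨e2, e1⟩ := (Nat.div_mod_unique (a := i + 1) (d := i / (2 * n)) hn).2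
        ⟨(by rw [add_right_comm, Nat.mod_add_div] : i % (2 * n) + 1 + _ = _), hl⟩
      rw [e2]
      have : θ ⟨i % (2 * n), Nat.mod_lt _ hn⟩ < θ ⟨(i + 1) % (2 * n), Nat.mod_lt _ hn⟩ :=
        hmono (Fin.mk_lt_mk.2 (by omega))
      linarith
    · have e2 : (i + 1) / (2 * n) = i / (2 * n) + 1 := by
        have := Nat.mod_add_div i (2 * n)
        have := Nat.mod_lt i hn
        exact ((Nat.div_mod_unique (c := 0) hn).2 ⟨by rw [Nat.mul_succ]; omega, hn⟩).1
      rw [e2]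
      have := hlt ⟨(i + 1) % (2 * n), Nat.mod_lt _ hn⟩ ⟨i % (2 * n), Nat.mod_lt _ hn⟩
      push_cast
      linarith
  · simp only [Nat.add_mod_right, Nat.add_div_right i hn]
    push_cast
    ring
  · rw [hp, circlePoint]
    simp [Nat.mod_eq_of_lt i.2, Nat.div_eq_of_lt i.2]

theorem gap_eq_dist_sq {p : Fin (2 * n) → EuclideanSpace ℝ (Fin 2)} {col : ℕ → Bool}
    {c : EuclideanSpace ℝ (Fin 2)} {r : ℝ} {Θ : ℕ → ℝ}
    (hp : ∀ i : Fin (2 * n), p i = circlePoint c r (Θ i)) {i : ℕ} (hi : i < 2 * n)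
    (hprv : prv (2 * n) col i < 2 * n) :
    gap (2 * n) col (coord p 0) (coord p 1) i =
      dist (circlePoint c r (Θ i)) (circlePoint c r (Θ (prv (2 * n) col i))) ^ 2 := by
  rw [← hp ⟨i, hi⟩, ← hp ⟨_, hprv⟩, EuclideanSpace.dist_sq_eq, Fin.sum_univ_two, Real.dist_eq,
    Real.dist_eq, sq_abs, sq_abs, gap]
  simp only [coord, hi, hprv, dif_pos]
  ring

theorem dist_le_bn (p : Fin (2 * n) → EuclideanSpace ℝ (Fin 2)) (m : Fin (2 * n) → Fin (2 * n))
    (i : Fin (2 * n)) : dist (p i) (p (m i)) ≤ bn p m :=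
  le_ciSup (f := fun i => dist (p i) (p (m i))) (Set.finite_range _).bddAbove i

theorem IsMatching.exists_good {p : Fin (2 * n) → EuclideanSpace ℝ (Fin 2)}
    {red : Fin (2 * n) → Bool} {m : Fin (2 * n) → Fin (2 * n)} (hm : IsMatching p red m)
    (h : Cyclic (2 * n) (colorAt red)) {c : EuclideanSpace ℝ (Fin 2)} {r : ℝ} {Θ : ℕ → ℝ}
    (hr : 0 < r) (hΘ : Angles (2 * n) Θ)
    (hp : ∀ i : Fin (2 * n), p i = circlePoint c r (Θ i)) :
    ∃ t ≤ 2 * (2 * n), Good (2 * n) (colorAt red) (coord p 0) (coord p 1) t (bn p m ^ 2) := by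
  have hpos := h.pos
  let M : ℕ → ℕ := fun i => m ⟨i % (2 * n), Nat.mod_lt _ hpos⟩
  have hMval : ∀ i : Fin (2 * n), M i = m i := by
    intro i
    simp only [M, Nat.mod_eq_of_lt i.2]
  obtain ⟨t, ht, hgood⟩ := exists_threshold (c := c) (r := r) h hΘ (M := M)
    (fun i hi => by
      have e := hMval ⟨i, hi⟩
      simp only at e
      refine ⟨by rw [e]; exact (m _).2, by rw [e, hMval, hm.involutive], ?_⟩
      rw [e, colorAt_val, show colorAt red i = red ⟨i, hi⟩ from colorAt_val red ⟨i, hi⟩]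
      exact hm.bichromatic _)
    -- Pairs that interleave in the cyclic order would have chords that meet.
    (fun a b a' b' h1 h2 h3 h4 h5 h6 => by
      have hP : ∀ x : ℕ, circlePoint c r (Θ x) = p ⟨x % (2 * n), Nat.mod_lt _ hpos⟩ := fun x => by
        rw [hp, hΘ.circlePoint_mod]
      have hmod : ∀ {x y : ℕ}, x < y → y < x + 2 * n → x % (2 * n) ≠ y % (2 * n) := by
        intro x y hxy hyx he
        have := (Nat.modEq_iff_dvd' hxy.le).1 he
        have := Nat.le_of_dvd (by omega) this
        omega
      have e5 : (⟨a' % (2 * n), Nat.mod_lt _ hpos⟩ : Fin (2 * n)) =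
          m ⟨a % (2 * n), Nat.mod_lt _ hpos⟩ :=
        Fin.ext (h5.trans (hMval ⟨a % (2 * n), Nat.mod_lt _ hpos⟩))
      have e6 : (⟨b' % (2 * n), Nat.mod_lt _ hpos⟩ : Fin (2 * n)) =
          m ⟨b % (2 * n), Nat.mod_lt _ hpos⟩ :=
        Fin.ext (h6.trans (hMval ⟨b % (2 * n), Nat.mod_lt _ hpos⟩))
      have hX := not_disjoint_of_interleaved (c := c) hr (hΘ.mono h1) (hΘ.mono h2) (hΘ.mono h3)
        (hΘ.lt_add h4)
      rw [hP, hP a', hP b, hP b', e5, e6] at hX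
      refine hX (hm.noncrossing _ _ ?_ ?_)
      · intro he; exact hmod h1 (by omega) (congrArg Fin.val he).symm
      · rw [← e5]; intro he; exact hmod h2 (by omega) (congrArg Fin.val he))
  refine ⟨t, ht, fun i hi hs => ?_⟩
  obtain ⟨q, hq, hle⟩ := hgood i hi hs
  rw [gap_eq_dist_sq hp hi (prv_lt h i)]
  refine hle.trans ?_
  have e := hMval ⟨q, hq⟩
  simp only at e
  rw [e, ← hp, ← hp ⟨q, hq⟩]
  exact pow_le_pow_left₀ dist_nonneg (dist_le_bn p m ⟨q, hq⟩) 2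

/-- The pairs selected by a threshold form a bottleneck matching if they are short enough. -/
theorem exists_isBottleneck {p : Fin (2 * n) → EuclideanSpace ℝ (Fin 2)}
    {red : Fin (2 * n) → Bool} (h : Cyclic (2 * n) (colorAt red)) (hp : OnCircle p) {T : ℕ}
    {o : ℕ → ℕ} (ho : ∀ i < 2 * n, Sel (2 * n) (colorAt red) T i →
      o i = prv (2 * n) (colorAt red) i ∧ o (prv (2 * n) (colorAt red) i) = i)
    (hopt : ∀ B t', 0 ≤ B → t' ≤ 2 * (2 * n) →
      Good (2 * n) (colorAt red) (coord p 0) (coord p 1) t' B →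
      Good (2 * n) (colorAt red) (coord p 0) (coord p 1) T B) :
    ∃ m : Fin (2 * n) → Fin (2 * n), (∀ i : Fin (2 * n), o i = m i) ∧ IsBottleneck p red m := by
  obtain ⟨c, r, Θ, hr, hΘ, hp⟩ := hp.exists_angles h.pos
  have : Nonempty (Fin (2 * n)) := ⟨⟨0, h.pos⟩⟩
  -- Each point is the end or the beginning of a selected arc: if `j` is not selected, the point `a`
  -- with predecessor `j` is, by `sel_prv`.
  have hpair : ∀ j < 2 * n, ∃ a < 2 * n, Sel (2 * n) (colorAt red) T a ∧
      (j = a ∧ o j = prv (2 * n) (colorAt red) a ∨ o j = a ∧ j = prv (2 * n) (colorAt red) a) := by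
    intro j hj
    by_cases hs : Sel (2 * n) (colorAt red) T j
    · exact ⟨j, hj, hs, .inl ⟨rfl, (ho j hj hs).1⟩⟩
    · obtain ⟨a, ha, rfl⟩ := exists_prv_eq h hj
      rw [sel_prv h, not_not] at hs
      exact ⟨a, ha, hs, .inr ⟨(ho a ha hs).2, rfl⟩⟩
  have holt : ∀ j < 2 * n, o j < 2 * n := by
    intro j hj
    obtain ⟨a, ha, -, ⟨-, e⟩ | ⟨e, -⟩⟩ := hpair j hj
    · rw [e]; exact prv_lt h a
    · rwa [e]
  refine ⟨fun j => ⟨o j, holt j j.2⟩, fun _ => rfl, ⟨fun j => Fin.ext (?_ : o (o j) = j), fun j => ?_,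
    fun i j hij hij' => ?_⟩, fun m' hm' => ?_⟩
  · obtain ⟨a, ha, hs, ⟨e1, e2⟩ | ⟨e1, e2⟩⟩ := hpair j j.2
    · rw [e2, (ho a ha hs).2, e1]
    · rw [e1, (ho a ha hs).1, e2]
  · rw [← colorAt_val red, ← colorAt_val red j]
    obtain ⟨a, ha, hs, ⟨e1, e2⟩ | ⟨e1, e2⟩⟩ := hpair j j.2
    · simp [e1, (ho a ha hs).1, col_prv h]
    · simp [e2, (ho a ha hs).2, col_prv h]
  · obtain ⟨a, ha, hsa, hja⟩ := hpair i i.2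
    obtain ⟨b, hb, hsb, hjb⟩ := hpair j j.2
    have hab : a ≠ b := by
      rintro rfl
      have n1 : (j : ℕ) ≠ i := fun he => hij (Fin.ext he)
      have n2 : (j : ℕ) ≠ o i := fun he => hij' (Fin.ext he)
      omega
    have hd := hsa.disjoint h hΘ hr ha hb hab hsb (c := c)
    rw [hp, hp, hp j, hp ⟨o j, _⟩]
    rcases hja with ⟨e1, e2⟩ | ⟨e1, e2⟩ <;> rcases hjb with ⟨e3, e4⟩ | ⟨e3, e4⟩ <;>
      simp only [e1, e3, e2, e4, ho a ha hsa, ho b hb hsb] <;> first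
      | exact hd
      | (rw [segment_symm]; exact hd)
      | (rw [segment_symm ℝ (circlePoint c r (Θ b))]; exact hd)
      | (rw [segment_symm, segment_symm ℝ (circlePoint c r (Θ b))]; exact hd)
  · obtain ⟨t, ht, hg⟩ := hm'.exists_good h hr hΘ hp
    have hg' := hopt _ t (sq_nonneg _) ht hg
    have h0 : 0 ≤ bn p m' := dist_nonneg.trans (dist_le_bn p m' (Classical.arbitrary _))
    refine ciSup_le fun j => ?_
    obtain ⟨a, ha, hs, hja⟩ := hpair j j.2
    have hle := hg' a ha hs
    rw [gap_eq_dist_sq hp ha (prv_lt h a)] at hle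
    have := (pow_le_pow_iff_left₀ dist_nonneg h0 two_ne_zero).1 hle
    rw [hp, hp]
    rcases hja with ⟨e1, e2⟩ | ⟨e1, e2⟩
    · simpa only [e1, e2, ho a ha hs] using this
    · rw [dist_comm]; simpa only [e1, e2, ho a ha hs] using this

end BottleneckMatching

theorem mainTheorem2 :
    ∃ (prog : RealRAM.Program) (C : ℕ),
      ∀ (n : ℕ) (p : Fin (2 * n) → EuclideanSpace ℝ (Fin 2)) (red : Fin (2 * n) → Bool),
        BottleneckMatching.OnCircle p → BottleneckMatching.Balanced red →
        ∃ (s : RealRAM.State) (t : ℕ) (m : Fin (2 * n) → Fin (2 * n)),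
          RealRAM.Exec prog (BottleneckMatching.input p red) s t ∧
          t ≤ C * (n + 1) ∧
          BottleneckMatching.Outputs s m ∧
          BottleneckMatching.IsBottleneck p red m := by
  refine ⟨BottleneckMatching.bottleneckProgram, BottleneckMatching.stepBound * 2,
    fun n p red hp hred => ?_⟩
  obtain ⟨s, t, T, hexec, ht, hout, hopt⟩ := BottleneckMatching.exec_bottleneckProgram
    (fun hn => hred.cyclic hn) (BottleneckMatching.holdsInput_input p red)
    (fun a ha => by
      funext i
      have h0 : a ≠ 0 := by omega
      have h1 : a ≠ 1 := by omega
      simp [BottleneckMatching.input, h0, h1])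
    (fun a ha => by
      funext i
      have h0 : a ≠ 0 := by omega
      have h1 : a ≠ 1 := by omega
      simp [BottleneckMatching.input, h0, h1])
  have ht' : t ≤ BottleneckMatching.stepBound * 2 * (n + 1) := by
    refine ht.trans ?_
    rw [mul_assoc]
    exact Nat.mul_le_mul_left _ (by omega)
  -- Without points there is no period to reduce indices by; the empty matching is then the only
  -- one.
  rcases Nat.eq_zero_or_pos n with rfl | hn
  · refine ⟨s, t, id, hexec, ht', fun i => i.elim0, ⟨fun i => i.elim0, fun i => i.elim0,
      fun i => i.elim0⟩, fun m' _ => ?_⟩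
    rw [show m' = id from funext fun i => i.elim0]
  · obtain ⟨m, hm, hb⟩ := BottleneckMatching.exists_isBottleneck (hred.cyclic (by omega)) hp
      hout hopt
    exact ⟨s, t, m, hexec, ht', hm, hb⟩
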